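/- **Finite-queue model.** Time is discrete. Finitely many packets arrive over time; a packet $p$ has a release time $r_p$, a value $w_p \ge 0$ and an integer deadline $d_p$. In every time step first the packets released in this step arrive, one by one, and then at most one packet stored in the queue is sent; packet $p$ must be sent in a step $t$ with $r_p \le t \le d_p$. At any time the queue stores at most $b \ge 1$ packets; packets may be dropped at any time, and a dropped or rejected packet is lost. The throughput is the total value of the packets sent; $\mathrm{OPT}(I)$ is the maximum throughput of an offline schedule for the input $I$. **Algorithm RME** with parameters $\alpha = \phi$ and $\gamma = 1/\phi^2$, where $\phi = (1+\sqrt 5)/2$. Each packet $p$ in the buffer carries a virtual deadline $t_p$, which is $d_p$ at its arrival. The routine $\mathrm{OPS}(S,t)$ goes through the packets of $S$ in non-increasing order of value (ties: larger virtual deadline first), puts each into the largest-indexed empty slot $i \in \{0,\dots,b-1\}$ with $t+i \le t_p$, discards it if there is no such slot, and finally sorts the selected packets by non-decreasing virtual deadline (ties: larger value first). For each packet $p$ arriving in step $t$, RME runs $\mathrm{OPS}(Q\cup\{p\},t)$ on its buffer $Q$ (and $\mathrm{OPS}(Q,t)$ if no packet arrives), keeps exactly the selected packets, and sets the virtual deadline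 of the packet in position $i = 0,1,\dots$ of the sorted queue to $t+i$. After the arrivals of step $t$, let $e$ be the packet with the earliest virtual deadline and $h$ the maximum-value packet (ties: earliest virtual deadline). If $w_e \ge w_h/\phi$, RME sends $e$. Otherwise it sends $e$ with probability $1/\phi^2$ and $h$ with probability $1 - 1/\phi^2$, independently of all earlier choices. A packet whose virtual deadline is $t$ and that is not sent in step $t$ leaves the buffer. **Theorem.** For every $b \ge 1$, RME is $\phi^2$-competitive ($\phi^2\approx 2.618$) in the finite-queue model with queue capacity $b$: it only produces schedules that are feasible in the model, and for every input $I$, $$\mathrm{OPT}(I) \le \phi^2 \cdot \mathbf{E}[\mathrm{RME}(I)],$$ where $\mathrm{RME}(I)$ is the throughput of RME on $I$. -/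

import Mathlib

open scoped NNReal ENNReal

noncomputable section

namespace FiniteQueue

/-! ## The finite-queue model -/

/-- A packet: release (arrival) time, non-negative value, and integer deadline. -/
structure Packet where
  release : ℕ
  weight : ℝ≥0
  deadline : ℕ

/-- An input sequence: finitely many packets. Packets released in the same time step arrive one by
one, in the order of their indices. -/
structure Input where
  size : ℕ
  packet : Fin size → Packet

namespace Input

variable (I : Input)

/-- A packet of the input sequence (as an individual, not only its characteristics). -/
abbrev Id : Type := Fin I.size

/-- The value `w_p`. -/
def w (p : I.Id) : ℝ≥0 := (I.packet p).weight

/-- The release time `r_p`. -/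
def r (p : I.Id) : ℕ := (I.packet p).release

/-- The real deadline `d_p`. -/
def d (p : I.Id) : ℕ := (I.packet p).deadline

/-- The packets arriving in time step `t`, in order of arrival. -/
def arrivals (t : ℕ) : List I.Id := (List.finRange I.size).filter fun p => I.r p = t

/-- The number of time steps after which every deadline has passed. -/
def horizon : ℕ := Finset.univ.sup I.d + 1

/-- A schedule says for each packet whether it is sent, and if so in which time step. -/
abbrev Schedule : Type := I.Id → Option ℕ

/-- A schedule can be realized with a queue of capacity `b`: packets are sent between release and
deadline, at most one packet is sent per time step, and at no time more than `b` packets have to be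
stored (a packet to be sent occupies the queue from its arrival until it is sent). -/
structure Feasible (b : ℕ) (S : I.Schedule) : Prop where
  release_le : ∀ p t, S p = some t → I.r p ≤ t
  le_deadline : ∀ p t, S p = some t → t ≤ I.d p
  one_per_step : ∀ p q t, S p = some t → S q = some t → p = q
  capacity : ∀ t, {p : I.Id | I.r p ≤ t ∧ ∃ s, S p = some s ∧ t ≤ s}.ncard ≤ b

/-- The weighted throughput: the total value of the packets that are sent. -/
def throughput (S : I.Schedule) : ℝ≥0 := ∑ p, if (S p).isSome then I.w p else 0

/-- The weighted throughput of an optimal offline algorithm with queue capacity `b`. -/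
def opt (b : ℕ) : ℝ≥0∞ := ⨆ (S : I.Schedule) (_ : I.Feasible b S), (I.throughput S : ℝ≥0∞)

/-- The expected weighted throughput of a random schedule. -/
def expectedThroughput (μ : PMF I.Schedule) : ℝ≥0∞ := ∑' S, μ S * (I.throughput S : ℝ≥0∞)

end Input

/-- A randomized algorithm, given by the random schedule that it produces on each input, is
(strictly) `c`-competitive for queue capacity `b`: it only produces schedules that are feasible in
the model, and on every input its expected throughput is at least `1 / c` of the optimum. -/
def IsCompetitive (b : ℕ) (c : ℝ) (A : (I : Input) → PMF I.Schedule) : Prop :=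
  ∀ I : Input, (∀ S ∈ (A I).support, I.Feasible b S) ∧
    I.opt b ≤ ENNReal.ofReal c * I.expectedThroughput (A I)

/-! ## The algorithm RME -/

section RME

variable (I : Input)

/-- A packet in the buffer together with its current virtual deadline. -/
structure Item where
  id : I.Id
  vd : ℕ
  deriving DecidableEq

variable {I}

/-- The order in which packets are considered: non-increasing value, ties broken in favor of the
larger virtual deadline. -/
def Item.byWeight (x y : Item I) : Prop :=
  I.w y.id < I.w x.id ∨ (I.w x.id = I.w y.id ∧ y.vd ≤ x.vd)

/-- The order of the resulting queue: non-decreasing virtual deadline, ties broken in favor of the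
larger value. -/
def Item.byDeadline (x y : Item I) : Prop :=
  x.vd < y.vd ∨ (x.vd = y.vd ∧ I.w y.id ≤ I.w x.id)

/-- The slots (indexed `0, …, b - 1`; slot `i` stands for time step `t + i`) that are not in `occ`
and not later than the virtual deadline `v`. -/
def freeSlots (b t v : ℕ) (occ : Finset ℕ) : Finset ℕ :=
  (Finset.range b).filter fun i => t + i ≤ v ∧ i ∉ occ

/-- Go through the list and put each packet into the latest free slot not after its virtual
deadline; discard it if there is none. Returns the packets that got a slot. -/
def fill (b t : ℕ) : List (Item I) → Finset ℕ → List (Item I)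
  | [], _ => []
  | x :: xs, occ =>
    if h : (freeSlots b t x.vd occ).Nonempty then
      x :: fill b t xs (insert ((freeSlots b t x.vd occ).max' h) occ)
    else fill b t xs occ

open Classical in
/-- The optimal provisional schedule `OPS(S, t)`, as a list in order of virtual deadlines. -/
def ops (b t : ℕ) (S : List (Item I)) : List (Item I) :=
  (fill b t (S.insertionSort Item.byWeight) ∅).insertionSort Item.byDeadline

/-- Run `OPS(S, t)`, drop the packets it does not select, and set the virtual deadline of the packet
in position `i` of the resulting queue to `t + i`. -/
def reschedule (b t : ℕ) (S : List (Item I)) : List (Item I) :=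
  (ops b t S).mapIdx fun i x => ⟨x.id, t + i⟩

/-- Arrival part of time step `t`: the arriving packets are handled one by one, each with its real
deadline as initial virtual deadline. The last `reschedule` covers steps without arrivals. -/
def arrive (b t : ℕ) (Q : List (Item I)) : List (Item I) :=
  reschedule b t
    ((I.arrivals t).foldl (fun Q p => reschedule b t (⟨p, I.d p⟩ :: Q)) Q)

/-- The event `β ∈ [0, γ]` for `β` uniform on `[0, 1]`: it is true with probability `γ`. -/
def coin (γ : unitInterval) : PMF Bool :=
  PMF.ofFintype (fun c => cond c (ENNReal.ofReal γ) (ENNReal.ofReal (1 - γ))) (by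
    rw [Fintype.sum_bool, cond_true, cond_false,
      ← ENNReal.ofReal_add γ.2.1 (sub_nonneg.2 γ.2.2)]
    simp)

open Classical in
/-- The (random) packet that is sent from the queue `Q`, which is in order of virtual deadlines. `e`
is its first packet and `h` the earliest packet of maximum value. If `w_e ≥ w_h / α`, send `e`;
otherwise send `e` with probability `γ` and `h` with probability `1 - γ`. -/
def choose (α : ℝ) (γ : unitInterval) (Q : List (Item I)) : PMF (Option (Item I)) :=
  match Q.head?, Q.argmax (fun x => I.w x.id) with
  | some e, some h =>
    if (I.w e.id : ℝ) ≥ (I.w h.id : ℝ) / α then PMF.pure (some e)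
    else (coin γ).map fun c => if c then some e else some h
  | _, _ => PMF.pure none

variable (I) in
/-- Configuration of the algorithm between time steps: its buffer, and the record of the packets it
has sent so far. -/
structure Config where
  queue : List (Item I)
  sent : I.Schedule

/-- Delivery in time step `t`: the packet `x` (if any) is sent and leaves the buffer, and so do the
packets that expire, i.e. whose virtual deadline is not after `t`. -/
def deliver (t : ℕ) (Q : List (Item I)) (sent : I.Schedule) : Option (Item I) → Config I
  | none => ⟨Q.filter fun y => t < y.vd, sent⟩
  | some x => ⟨(Q.erase x).filter fun y => t < y.vd, Function.update sent x.id (some t)⟩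

/-- One time step of RME with queue capacity `b`. -/
def step (b : ℕ) (α : ℝ) (γ : unitInterval) (t : ℕ) (C : Config I) : PMF (Config I) :=
  (choose α γ (arrive b t C.queue)).map (deliver t (arrive b t C.queue) C.sent)

variable (I) in
/-- The random configuration before time step `t`; the coins of different steps are independent. -/
def run (b : ℕ) (α : ℝ) (γ : unitInterval) : ℕ → PMF (Config I)
  | 0 => PMF.pure ⟨[], fun _ => none⟩
  | t + 1 => (run b α γ t).bind (step b α γ t)

end RME

/-- The randomized algorithm RME with queue capacity `b` and parameters `α`, `γ`. -/
def rme (b : ℕ) (α : ℝ) (γ : unitInterval) (I : Input) : PMF I.Schedule :=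
  (run I b α γ I.horizon).map Config.sent

/-- The number `1 / φ ^ 2`, as an element of `[0, 1]`. -/
def invGoldenSq : unitInterval :=
  ⟨1 / Real.goldenRatio ^ 2, by positivity, by
    rw [div_le_one (by positivity)]
    nlinarith [Real.one_lt_goldenRatio]⟩

end FiniteQueue

end

/-!
The analysis compares the algorithm with a fixed feasible schedule `S`, called the reference
schedule, by a potential function. Slots are absolute time steps. At every moment let `B` be the set
of remaining slots in which `S` sends a packet that has already arrived, so that `B` has at most `b`
elements. Values are cut into levels: with suitable gaps between the levels, the value of a packet is
the sum of the gaps of the levels up to it (`exists_gap`), so everything can be counted level by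
level.

*Potential.* Assign non-increasing prices `m` to the slots. At level `x` one counts the packets in the
buffer of value at least `x` (`heavy`), plus those among them whose slot costs at least `x` but no
more than their value (`paid`), minus the slots of price at least `x` that `S` leaves unused (`idle`).
The contribution of the level (`levelPot`) is this number, capped by the size of `B`. The potential of
a buffer is the supremum over all prices of the sum of these contributions, scaled by the gaps of
the levels (`optPot`).

*Claim.* The value of all packets released before step `n` that `S` ever sends is at most the
expectation of `φ ^ 2` times the throughput so far plus the potential
(`IsLevels.committed_le_expect_run`). At the horizon `B` is empty, the potential vanishes, and the
claim becomes the competitive ratio.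

*Arrivals.* When `p` arrives, `OPS` keeps everything, or discards `p` because its deadline has passed,
or discards a packet `z` that is worth least among the packets competing for the slots up to the
latest slot of `p`, all of which are in use (`Slotted.ops_cons`, a Hall-type argument for the greedy
algorithm). In the last case the prices of these slots are raised to at least the value of `z`: each
newly expensive slot turns its packet into a paid one, which makes up for the slot if `S` leaves it
unused, and the slot of `p` itself is not unused (`exists_price_ops`). If `S` sends `p` after the last
slot of the buffer, then all `b` slots hold packets worth at least `z`, and the cap by the size of `B`
is attained. Tightening virtual deadlines is harmless, since a slot can take over the price of the
latest slot of its packet (`exists_price_reschedule`).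

*Delivery.* The loss of potential at each level is at most a multiple of the indicators that the level
is below the value of the first packet `e` or of the best packet `h`. When `e` is sent because it is
worth nearly as much as `h`, the loss is at most `w_e + w_h ≤ φ ^ 2 * w_e`. Otherwise three cases are
distinguished (`exists_price_deliver`): the slot of `e` costs more than `e`; it does not and few
packets are better than `e`; it does not and many packets are better, in which case all prices are
reset to zero. In each of them the expected loss is at most `φ ^ 2` times the expected gain
(`coin_budget`).

Feasibility of the schedules produced is an invariant of the reachable configurations (`Reachable`).
-/

open scoped NNReal ENNReal

noncomputable section

namespace FiniteQueue

/-! ### Expectations and levels of value -/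

/-- The expectation of `f` under a discrete distribution. -/
def expect {α : Type*} (μ : PMF α) (f : α → ℝ≥0∞) : ℝ≥0∞ := ∑' a, μ a * f a

lemma expect_pure {α : Type*} (a : α) (f : α → ℝ≥0∞) : expect (PMF.pure a) f = f a := by
  unfold expect
  rw [tsum_eq_single a]
  · simp
  · intro b hb
    simp [PMF.pure_apply, hb]

lemma expect_bind {α β : Type*} (μ : PMF α) (k : α → PMF β) (f : β → ℝ≥0∞) :
    expect (μ.bind k) f = expect μ fun a => expect (k a) f := by
  unfold expect
  simp only [PMF.bind_apply, ← ENNReal.tsum_mul_right, ← ENNReal.tsum_mul_left]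
  rw [ENNReal.tsum_comm]
  simp only [mul_assoc]

lemma expect_map {α β : Type*} (μ : PMF α) (g : α → β) (f : β → ℝ≥0∞) :
    expect (μ.map g) f = expect μ fun a => f (g a) := by
  rw [PMF.map, expect_bind]
  simp only [Function.comp_apply, expect_pure]

lemma expect_const_add {α : Type*} (μ : PMF α) (f : α → ℝ≥0∞) (c : ℝ≥0∞) :
    expect μ (fun a => f a + c) = expect μ f + c := by
  unfold expect
  simp only [mul_add]
  rw [ENNReal.tsum_add, ENNReal.tsum_mul_right, μ.tsum_coe, one_mul]

lemma expect_mono {α : Type*} (μ : PMF α) {f g : α → ℝ≥0∞} (h : ∀ a ∈ μ.support, f a ≤ g a) :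
    expect μ f ≤ expect μ g := by
  refine ENNReal.tsum_le_tsum fun a => ?_
  by_cases ha : μ a = 0
  · simp [ha]
  · gcongr
    exact h a ((PMF.mem_support_iff _ _).2 ha)

lemma expect_coin (γ : unitInterval) (f : Bool → ℝ≥0∞) :
    expect (coin γ) f =
      ENNReal.ofReal γ * f true + ENNReal.ofReal (1 - γ) * f false := by
  unfold expect coin
  rw [tsum_fintype, Fintype.sum_bool]
  simp [PMF.ofFintype_apply]

/-- Every finite set of levels has a family of gaps that telescopes: the gaps up to the value `v`
add up to the largest level not above `v`. -/
lemma exists_gap (s : Finset ℝ≥0) :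
    ∃ g : ℝ≥0 → ℝ≥0, ∀ v, ∑ x ∈ s with x ≤ v, g x = (s.filter (· ≤ v)).sup id := by
  induction s using Finset.induction_on_max with
  | empty => exact ⟨0, by simp⟩
  | insert a s hs ih =>
    obtain ⟨g, hg⟩ := ih
    have ha : a ∉ s := fun h => (hs a h).ne rfl
    have hfa : s.filter (· ≤ a) = s := Finset.filter_true_of_mem fun x hx => (hs x hx).le
    have hle : s.sup id ≤ a := Finset.sup_le fun x hx => (hs x hx).le
    refine ⟨Function.update g a (a - s.sup id), fun v => ?_⟩
    have hcongr : ∀ u : Finset ℝ≥0, u ⊆ s →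
        ∑ x ∈ u, Function.update g a (a - s.sup id) x = ∑ x ∈ u, g x := fun u hu =>
      Finset.sum_congr rfl fun x hx =>
        Function.update_of_ne (ne_of_mem_of_not_mem (hu hx) ha) _ _
    by_cases hv : a ≤ v
    · have : s.filter (· ≤ v) = s := Finset.filter_true_of_mem fun x hx => (hs x hx).le.trans hv
      rw [Finset.filter_insert, if_pos hv, this, Finset.sum_insert ha, hcongr s subset_rfl,
        Function.update_self, Finset.sup_insert]
      have h2 := hg a
      rw [hfa] at h2
      rw [h2, tsub_add_cancel_of_le hle]
      exact (sup_eq_left.2 hle).symm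
    · rw [Finset.filter_insert, if_neg hv, hcongr _ (Finset.filter_subset _ _), hg]

/-! ### The greedy selection of packets -/

variable {I : Input}

instance : Std.Total (Item.byWeight (I := I)) where
  total x y := by
    unfold Item.byWeight
    rcases lt_trichotomy (I.w x.id) (I.w y.id) with h | h | h
    · exact .inr (.inl h)
    · rcases le_total y.vd x.vd with h' | h'
      · exact .inl (.inr ⟨h, h'⟩)
      · exact .inr (.inr ⟨h.symm, h'⟩)
    · exact .inl (.inl h)

instance : IsTrans (Item I) Item.byWeight where
  trans x y z := by
    unfold Item.byWeight
    rintro (h | ⟨h, h'⟩) (k | ⟨k, k'⟩)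
    · exact .inl (k.trans h)
    · exact .inl (k ▸ h)
    · exact .inl (h ▸ k)
    · exact .inr ⟨h.trans k, k'.trans h'⟩

instance : Std.Total (Item.byDeadline (I := I)) where
  total x y := by
    unfold Item.byDeadline
    rcases lt_trichotomy x.vd y.vd with h | h | h
    · exact .inl (.inl h)
    · rcases le_total (I.w y.id) (I.w x.id) with h' | h'
      · exact .inl (.inr ⟨h, h'⟩)
      · exact .inr (.inr ⟨h.symm, h'⟩)
    · exact .inr (.inl h)

instance : IsTrans (Item I) Item.byDeadline where
  trans x y z := by
    unfold Item.byDeadline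
    rintro (h | ⟨h, h'⟩) (k | ⟨k, k'⟩)
    · exact .inl (h.trans k)
    · exact .inl (k ▸ h)
    · exact .inl (h ▸ k)
    · exact .inr ⟨h.trans k, k'.trans h'⟩

lemma Item.byWeight.weight_le {x y : Item I} (h : x.byWeight y) : I.w y.id ≤ I.w x.id :=
  h.elim le_of_lt fun h => h.1.ge

lemma Item.byDeadline.vd_le {x y : Item I} (h : x.byDeadline y) : x.vd ≤ y.vd :=
  h.elim le_of_lt fun h => h.1.le

/-- The latest of the `b` slots from `t` on in which `y` may be placed, as a slot index. -/
def lastSlot (b t : ℕ) (y : Item I) : ℕ := min (y.vd - t) (b - 1)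

/-- The number of unexpired packets whose latest slot index lies in `[x, y)`. -/
def demand (b t x y : ℕ) (l : List (Item I)) : ℕ :=
  l.countP fun z => t ≤ z.vd ∧ x ≤ lastSlot b t z ∧ lastSlot b t z < y

lemma demand_append (b t x y : ℕ) (l l' : List (Item I)) :
    demand b t x y (l ++ l') = demand b t x y l + demand b t x y l' := List.countP_append

lemma demand_cons (b t x y : ℕ) (z : Item I) (l : List (Item I)) :
    demand b t x y (z :: l) = demand b t x y l +
      if t ≤ z.vd ∧ x ≤ lastSlot b t z ∧ lastSlot b t z < y then 1 else 0 := by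
  simp [demand, List.countP_cons]

lemma demand_perm {b t x y : ℕ} {l l' : List (Item I)} (h : l.Perm l') :
    demand b t x y l = demand b t x y l' := h.countP_eq _

lemma mem_freeSlots {b t v i : ℕ} {occ : Finset ℕ} :
    i ∈ freeSlots b t v occ ↔ i < b ∧ t + i ≤ v ∧ i ∉ occ := by
  simp [freeSlots]

/-- The slots occupied by the greedy algorithm are accounted for by the packets placed so far: an
interval of slots that is followed by a free slot (or by the end of the queue) is occupied only by
packets whose latest slot lies in that interval. -/
structure Accounted (b t : ℕ) (occ : Finset ℕ) (l : List (Item I)) : Prop where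
  lt : ∀ i ∈ occ, i < b
  card_le : ∀ x y, y ≤ b → y ∉ occ → (occ ∩ Finset.Ico x y).card ≤ demand b t x y l

lemma accounted_empty (b t : ℕ) : Accounted b t ∅ ([] : List (Item I)) :=
  ⟨by simp, by simp⟩

lemma Accounted.insert {b t : ℕ} (hb : 0 < b) {occ : Finset ℕ} {l : List (Item I)}
    (h : Accounted b t occ l) (x : Item I) (hf : (freeSlots b t x.vd occ).Nonempty) :
    Accounted b t (insert ((freeSlots b t x.vd occ).max' hf) occ) (l ++ [x]) := by
  obtain ⟨hfb, hfv, hfo⟩ := mem_freeSlots.1 (Finset.max'_mem _ hf)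
  have hmax : ∀ i ∈ freeSlots b t x.vd occ, i ≤ (freeSlots b t x.vd occ).max' hf :=
    fun i hi => Finset.le_max' _ i hi
  set f := (freeSlots b t x.vd occ).max' hf
  constructor
  · intro i hi
    rcases Finset.mem_insert.1 hi with rfl | hi
    · exact hfb
    · exact h.lt i hi
  · intro u v hv hvo
    have hvo' : v ≠ f ∧ v ∉ occ := by simpa using hvo
    have h1 := h.card_le u v hv hvo'.2
    rw [demand_append, demand_cons]
    by_cases hfi : f ∈ Finset.Ico u v
    · rw [Finset.insert_inter_of_mem hfi, Finset.card_insert_of_notMem (by simp [hfo])]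
      have hfi' := Finset.mem_Ico.1 hfi
      have hlt : lastSlot b t x < v := by
        by_contra hcon
        have hcon : v ≤ lastSlot b t x := not_lt.1 hcon
        unfold lastSlot at hcon
        have := hmax v (mem_freeSlots.2 ⟨by omega, by omega, hvo'.2⟩)
        omega
      have : t ≤ x.vd ∧ u ≤ lastSlot b t x ∧ lastSlot b t x < v :=
        ⟨by omega, by unfold lastSlot; omega, hlt⟩
      rw [if_pos this]
      omega
    · rw [Finset.insert_inter_of_notMem hfi]
      omega

/-- If a packet finds no free slot, all slots up to some `v` beyond its latest slot are occupied, and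
the packets placed so far need them. -/
lemma Accounted.exists_full {b t : ℕ} (hb : 0 < b) {occ : Finset ℕ} {l : List (Item I)}
    (h : Accounted b t occ l) {z : Item I} (hz : t ≤ z.vd)
    (hf : ¬ (freeSlots b t z.vd occ).Nonempty) :
    ∃ v ≤ b, lastSlot b t z < v ∧ ∀ u, v - u ≤ demand b t u v l := by
  have hex : ∃ v, lastSlot b t z < v ∧ v ∉ occ :=
    ⟨b, by unfold lastSlot; omega, fun hb => lt_irrefl _ (h.lt b hb)⟩
  classical
  obtain ⟨hv1, hv2⟩ := Nat.find_spec hex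
  have hvmin : ∀ m < Nat.find hex, ¬ (lastSlot b t z < m ∧ m ∉ occ) := fun m => Nat.find_min hex
  have hvb : Nat.find hex ≤ b :=
    Nat.find_min' hex ⟨by unfold lastSlot; omega, fun hb => lt_irrefl _ (h.lt b hb)⟩
  set v := Nat.find hex
  refine ⟨v, hvb, hv1, fun u => ?_⟩
  have hocc : ∀ i < v, i ∈ occ := by
    intro i hi
    by_contra hio
    by_cases hiz : i ≤ lastSlot b t z
    · refine hf ⟨i, mem_freeSlots.2 ⟨by omega, ?_, hio⟩⟩
      unfold lastSlot at hiz
      omega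
    · exact hvmin i hi ⟨not_le.1 hiz, hio⟩
  have hsub : Finset.Ico u v ⊆ occ := fun i hi => hocc i (Finset.mem_Ico.1 hi).2
  have := h.card_le u v hvb hv2
  rwa [Finset.inter_eq_right.2 hsub, Nat.card_Ico] at this

/-- Under Hall's condition the greedy algorithm discards nothing. -/
lemma fill_eq_self {b t : ℕ} (hb : 0 < b) (l : List (Item I)) :
    ∀ (l₀ : List (Item I)) (occ : Finset ℕ), Accounted b t occ l₀ → (∀ y ∈ l, t ≤ y.vd) →
      (∀ v ≤ b, demand b t 0 v (l₀ ++ l) ≤ v) → fill b t l occ = l := by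
  induction l with
  | nil => intros; rfl
  | cons x l ih =>
    intro l₀ occ h hl hall
    have hx : t ≤ x.vd := hl x (by simp)
    rw [fill]
    split_ifs with hf
    · rw [ih (l₀ ++ [x]) _ (h.insert hb x hf) (fun y hy => hl y (by simp [hy])) (by simpa using hall)]
    · exfalso
      obtain ⟨v, hvb, hzv, hv⟩ := h.exists_full hb hx hf
      have h1 := hall v hvb
      have h2 := hv 0
      rw [demand_append, demand_cons, if_pos ⟨hx, Nat.zero_le _, hzv⟩] at h1
      omega

/-- Either everything is placed, or there is a first packet that is discarded. -/
lemma fill_cases {b t : ℕ} (hb : 0 < b) (l : List (Item I)) :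
    ∀ (l₀ : List (Item I)) (occ : Finset ℕ), Accounted b t occ l₀ →
      fill b t l occ = l ∨ ∃ l₁ z l₂ occ', l = l₁ ++ z :: l₂ ∧
        fill b t l occ = l₁ ++ fill b t l₂ occ' ∧ Accounted b t occ' (l₀ ++ l₁) ∧
        ¬ (freeSlots b t z.vd occ').Nonempty := by
  induction l with
  | nil => intros; exact .inl rfl
  | cons x l ih =>
    intro l₀ occ h
    rw [fill]
    split_ifs with hf
    · rcases ih (l₀ ++ [x]) _ (h.insert hb x hf) with h' | ⟨l₁, z, l₂, occ', rfl, h2, h3, h4⟩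
      · exact .inl (by rw [h'])
      · exact .inr ⟨x :: l₁, z, l₂, occ', rfl, by rw [h2]; rfl, by simpa using h3, h4⟩
    · exact .inr ⟨[], x, l, occ, rfl, rfl, by simpa using h, hf⟩

/-- A buffer in which every packet has its own slot among the `b` slots from `t` on. -/
structure Slotted (b t : ℕ) (Q : List (Item I)) : Prop where
  nodup : (Q.map Item.vd).Nodup
  le_vd : ∀ y ∈ Q, t ≤ y.vd
  vd_lt : ∀ y ∈ Q, y.vd < t + b

lemma Slotted.lastSlot_eq {b t : ℕ} {Q : List (Item I)} (h : Slotted b t Q) {y : Item I}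
    (hy : y ∈ Q) : lastSlot b t y = y.vd - t := by
  have := h.le_vd y hy
  have := h.vd_lt y hy
  unfold lastSlot
  omega

/-- The slots in `[t + u, t + v)` that are in use. -/
lemma Slotted.demand_eq {b t : ℕ} {Q : List (Item I)} (h : Slotted b t Q) (u v : ℕ) :
    demand b t u v Q = ((Q.map Item.vd).toFinset ∩ Finset.Ico (t + u) (t + v)).card := by
  have h1 : (Q.map Item.vd).toFinset ∩ Finset.Ico (t + u) (t + v) =
      ((Q.filter fun z => t ≤ z.vd ∧ u ≤ lastSlot b t z ∧ lastSlot b t z < v).map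
        Item.vd).toFinset := by
    ext s
    simp only [Finset.mem_inter, List.mem_toFinset, List.mem_map, Finset.mem_Ico, List.mem_filter,
      decide_eq_true_eq]
    constructor
    · rintro ⟨⟨y, hy, rfl⟩, h1, h2⟩
      have := h.le_vd y hy
      exact ⟨y, ⟨hy, this, by rw [h.lastSlot_eq hy]; omega, by rw [h.lastSlot_eq hy]; omega⟩, rfl⟩
    · rintro ⟨y, ⟨hy, h0, h1, h2⟩, rfl⟩
      rw [h.lastSlot_eq hy] at h1 h2
      exact ⟨⟨y, hy, rfl⟩, by omega, by omega⟩
  rw [h1, List.toFinset_card_of_nodup]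
  · rw [List.length_map, ← List.countP_eq_length_filter, demand]
  · exact h.nodup.sublist (List.filter_sublist.map _)

lemma Slotted.demand_le {b t : ℕ} {Q : List (Item I)} (h : Slotted b t Q) (u v : ℕ) :
    demand b t u v Q ≤ v - u := by
  rw [h.demand_eq]
  refine (Finset.card_le_card Finset.inter_subset_right).trans ?_
  rw [Nat.card_Ico]
  omega

lemma Slotted.exists_of_demand_eq {b t : ℕ} {Q : List (Item I)} (h : Slotted b t Q) {v : ℕ}
    (hv : v ≤ demand b t 0 v Q) {s : ℕ} (hts : t ≤ s) (hsv : s < t + v) : ∃ y ∈ Q, y.vd = s := by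
  rw [h.demand_eq] at hv
  have := Finset.eq_of_subset_of_card_le
    (Finset.inter_subset_right (s₁ := (Q.map Item.vd).toFinset)
      (s₂ := Finset.Ico (t + 0) (t + v))) (by rw [Nat.card_Ico]; omega)
  have hs : s ∈ Finset.Ico (t + 0) (t + v) := Finset.mem_Ico.2 ⟨by omega, hsv⟩
  rw [← this] at hs
  simpa using (Finset.mem_inter.1 hs).1

open Classical in
/-- The packets in the order in which `ops` considers them, and what it keeps. -/
lemma exists_sorted_perm (b t : ℕ) (S : List (Item I)) :
    ∃ l, l.Perm S ∧ l.Pairwise Item.byWeight ∧ (ops b t S).Perm (fill b t l ∅) :=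
  ⟨S.insertionSort Item.byWeight, List.perm_insertionSort _ _, List.pairwise_insertionSort _ _,
    List.perm_insertionSort _ _⟩

open Classical in
lemma ops_pairwise (b t : ℕ) (S : List (Item I)) :
    (ops b t S).Pairwise fun x y => x.vd ≤ y.vd :=
  (List.pairwise_insertionSort Item.byDeadline _).imp Item.byDeadline.vd_le

/-- `OPS` keeps every packet of a buffer in which each packet already has its own slot. -/
lemma Slotted.ops_perm {b t : ℕ} (hb : 0 < b) {Q : List (Item I)} (h : Slotted b t Q) :
    (ops b t Q).Perm Q := by
  obtain ⟨l, hl, -, hops⟩ := exists_sorted_perm b t Q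
  rw [fill_eq_self hb l [] ∅ (accounted_empty b t) (fun y hy => h.le_vd y (hl.mem_iff.1 hy))
    (fun v _ => by simpa [demand_perm hl] using h.demand_le 0 v)] at hops
  exact hops.trans hl

/-- What `OPS` does when the packet `p` joins a buffer: it keeps everything, or discards `p` because
its deadline has passed, or discards a packet `z` of least value among all packets that compete for
the slots up to the latest slot of `p`, which are all in use. -/
lemma Slotted.ops_cons {b t : ℕ} (hb : 0 < b) {Q : List (Item I)} (h : Slotted b t Q)
    (p : Item I) :
    (ops b t (p :: Q)).Perm (p :: Q) ∨ (p.vd < t ∧ (ops b t (p :: Q)).Perm Q) ∨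
      ∃ z, (z :: ops b t (p :: Q)).Perm (p :: Q) ∧ t ≤ p.vd ∧ I.w z.id ≤ I.w p.id ∧
        lastSlot b t z ≤ lastSlot b t p ∧
        ∀ s, t ≤ s → s ≤ t + lastSlot b t p → ∃ y ∈ Q, y.vd = s ∧ I.w z.id ≤ I.w y.id := by
  obtain ⟨l, hl, hsort, hops⟩ := exists_sorted_perm b t (p :: Q)
  rcases fill_cases hb l [] ∅ (accounted_empty b t) with hfill | ⟨l₁, z, l₂, occ, rfl, hfill, hacc, hz⟩
  · rw [hfill] at hops
    exact .inl (hops.trans hl)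
  right
  rw [List.nil_append] at hacc
  rw [hfill] at hops
  have hperm : (z :: (l₁ ++ l₂)).Perm (p :: Q) := List.perm_middle.symm.trans hl
  -- after a discarded packet, Hall's condition holds, so nothing else is discarded
  have hrest : (∀ y ∈ l₁ ++ l₂, t ≤ y.vd) → (∀ v ≤ b, demand b t 0 v (l₁ ++ l₂) ≤ v) →
      (ops b t (p :: Q)).Perm (l₁ ++ l₂) := fun h1 h2 => by
    rw [fill_eq_self hb l₂ l₁ occ hacc (fun y hy => h1 y (by simp [hy])) h2] at hops
    exact hops
  have hdem : ∀ u v, demand b t u v (z :: (l₁ ++ l₂)) = demand b t u v (p :: Q) := fun u v =>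
    demand_perm hperm
  have hmem : ∀ y, y = z ∨ y ∈ l₁ ++ l₂ ↔ y = p ∨ y ∈ Q := fun y => by
    simpa using hperm.mem_iff (a := y)
  by_cases hzt : t ≤ z.vd
  · right
    obtain ⟨v, hvb, hzv, hv⟩ := hacc.exists_full hb hzt hz
    have hQ : ∀ u, demand b t u v Q ≤ v - u := fun u => h.demand_le u v
    -- the packets placed before `z`, together with `z`, exceed the slots by one, so `p` is
    -- one of them and the buffer fills all these slots
    have hp : t ≤ p.vd ∧ lastSlot b t z ≤ lastSlot b t p ∧ lastSlot b t p < v := by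
      by_contra hcon
      have h1 := hdem (lastSlot b t z) v
      have h2 := hv (lastSlot b t z)
      have h3 := hQ (lastSlot b t z)
      rw [demand_cons, demand_cons, demand_append, if_pos ⟨hzt, le_rfl, hzv⟩, if_neg hcon] at h1
      omega
    have h1 := hdem 0 v
    have h2 := hv 0
    have h3 := hQ 0
    rw [demand_cons, demand_cons, demand_append, if_pos ⟨hzt, Nat.zero_le _, hzv⟩,
      if_pos ⟨hp.1, Nat.zero_le _, hp.2.2⟩] at h1
    have hl₂ : demand b t 0 v l₂ = 0 := by omega
    have hfull : v ≤ demand b t 0 v Q := by omega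
    have hheavy : ∀ y, (y = p ∨ y ∈ Q) → t ≤ y.vd → lastSlot b t y < v →
        I.w z.id ≤ I.w y.id := by
      intro y hy hty hyv
      rcases (hmem y).2 hy with rfl | hy
      · exact le_rfl
      rcases List.mem_append.1 hy with hy | hy
      · exact ((List.pairwise_append.1 hsort).2.2 y hy z (by simp)).weight_le
      · unfold demand at hl₂
        rw [List.countP_eq_zero] at hl₂
        exact absurd (by simpa using ⟨hty, hyv⟩) (hl₂ y hy)
    refine ⟨z, ?_, hp.1, hheavy p (.inl rfl) hp.1 hp.2.2, hp.2.1, ?_⟩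
    · refine (List.Perm.cons z (hrest ?_ ?_)).trans hperm
      · intro y hy
        rcases (hmem y).1 (.inr hy) with rfl | hy
        · exact hp.1
        · exact h.le_vd y hy
      · intro v' _
        have h4 := hdem 0 v'
        have h5 := h.demand_le 0 v'
        rw [demand_cons, demand_cons] at h4
        split_ifs at h4 <;> omega
    · intro s hts hs
      obtain ⟨y, hy, rfl⟩ := h.exists_of_demand_eq hfull hts (by omega)
      exact ⟨y, hy, rfl, hheavy y (.inr hy) hts (by rw [h.lastSlot_eq hy]; omega)⟩
  · left
    -- the buffer holds no expired packet, so the expired packet `z` is `p`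
    have hzp : z = p := by
      rcases (hmem z).1 (.inl rfl) with h' | h'
      · exact h'
      · exact absurd (h.le_vd z h') hzt
    subst hzp
    have hQl : (l₁ ++ l₂).Perm Q := hperm.cons_inv
    refine ⟨not_le.1 hzt, (hrest ?_ ?_).trans hQl⟩
    · exact fun y hy => h.le_vd y (hQl.mem_iff.1 hy)
    · exact fun v _ => by simpa [demand_perm hQl] using h.demand_le 0 v

/-- The packets that are placed fit into the slots that are free at the start. -/
lemma countP_fill_add_card_le (b t k : ℕ) (l : List (Item I)) :
    ∀ occ : Finset ℕ, (fill b t l occ).countP (fun y => y.vd < t + k) +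
      (occ ∩ Finset.range k).card ≤ k := by
  induction l with
  | nil =>
    intro occ
    have := Finset.card_le_card (Finset.inter_subset_right (s₁ := occ) (s₂ := Finset.range k))
    simpa [fill] using this
  | cons x l ih =>
    intro occ
    rw [fill]
    split_ifs with hf
    · obtain ⟨hfb, hfv, hfo⟩ := mem_freeSlots.1 (Finset.max'_mem _ hf)
      have := ih (insert ((freeSlots b t x.vd occ).max' hf) occ)
      set f := (freeSlots b t x.vd occ).max' hf
      rw [List.countP_cons]
      by_cases hfk : f < k
      · rw [Finset.insert_inter_of_mem (Finset.mem_range.2 hfk),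
          Finset.card_insert_of_notMem (by simp [hfo])] at this
        split_ifs <;> omega
      · have hx : ¬ x.vd < t + k := by omega
        rw [Finset.insert_inter_of_notMem (by simpa using hfk)] at this
        simpa [hx] using this
    · exact ih occ

lemma length_fill_add_card_le (b t : ℕ) (l : List (Item I)) :
    ∀ occ : Finset ℕ, (∀ i ∈ occ, i < b) → (fill b t l occ).length + occ.card ≤ b := by
  induction l with
  | nil =>
    intro occ hocc
    simpa [fill] using Finset.card_le_card (t := Finset.range b) (s := occ) fun i hi => by
      simpa using hocc i hi
  | cons x l ih =>
    intro occ hocc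
    rw [fill]
    split_ifs with hf
    · obtain ⟨hfb, hfv, hfo⟩ := mem_freeSlots.1 (Finset.max'_mem _ hf)
      have := ih (insert ((freeSlots b t x.vd occ).max' hf) occ) (by
        intro i hi
        rcases Finset.mem_insert.1 hi with rfl | hi
        · exact hfb
        · exact hocc i hi)
      rw [Finset.card_insert_of_notMem hfo] at this
      rw [List.length_cons]
      omega
    · exact ih occ hocc

lemma length_ops_le (b t : ℕ) (S : List (Item I)) : (ops b t S).length ≤ b := by
  obtain ⟨l, -, -, hops⟩ := exists_sorted_perm b t S
  rw [hops.length_eq]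
  simpa using length_fill_add_card_le b t l ∅ (by simp)

/-- The packet in position `i` of the sorted queue may be sent in step `t + i`. -/
lemma le_vd_ops_getElem (b t : ℕ) (S : List (Item I)) {i : ℕ} (hi : i < (ops b t S).length) :
    t + i ≤ ((ops b t S)[i]).vd := by
  by_contra hcon
  rw [not_le] at hcon
  obtain ⟨l, -, -, hops⟩ := exists_sorted_perm b t S
  have h1 := countP_fill_add_card_le b t i l ∅
  rw [← hops.countP_eq] at h1
  have h2 : ((ops b t S).take (i + 1)).countP (fun y => y.vd < t + i) = i + 1 := by
    rw [List.countP_eq_length.2, List.length_take]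
    · omega
    · intro y hy
      obtain ⟨j, hj, rfl⟩ := List.mem_iff_getElem.1 hy
      rw [List.length_take] at hj
      rw [List.getElem_take, decide_eq_true_eq]
      rcases (by omega : j < i ∨ j = i) with hji | rfl
      · exact ((List.pairwise_iff_getElem.1 (ops_pairwise b t S)) j i _ hi hji).trans_lt hcon
      · exact hcon
  have h3 := (List.take_sublist (i + 1) (ops b t S)).countP_le (p := fun y => y.vd < t + i)
  simp only [Finset.empty_inter, Finset.card_empty] at h1
  omega

/-! ### Prices and the potential of a level -/

lemma length_reschedule (b t : ℕ) (S : List (Item I)) :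
    (reschedule b t S).length = (ops b t S).length := by
  simp [reschedule]

lemma getElem_reschedule (b t : ℕ) (S : List (Item I)) {i : ℕ}
    (hi : i < (reschedule b t S).length) :
    (reschedule b t S)[i] =
      ⟨((ops b t S)[i]'(length_reschedule b t S ▸ hi)).id, t + i⟩ := by
  simp [reschedule]

lemma map_id_reschedule (b t : ℕ) (S : List (Item I)) :
    (reschedule b t S).map Item.id = (ops b t S).map Item.id := by
  refine List.ext_getElem (by simp [length_reschedule]) fun i h1 h2 => ?_
  simp [getElem_reschedule]

lemma map_vd_reschedule (b t : ℕ) (S : List (Item I)) :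
    (reschedule b t S).map Item.vd = List.range' t (ops b t S).length := by
  refine List.ext_getElem (by simp [length_reschedule]) fun i h1 h2 => ?_
  simp [getElem_reschedule]

lemma slotted_reschedule (b t : ℕ) (S : List (Item I)) : Slotted b t (reschedule b t S) := by
  have hmem : ∀ y ∈ reschedule b t S, y.vd ∈ List.range' t (ops b t S).length := fun y hy => by
    rw [← map_vd_reschedule]
    exact List.mem_map_of_mem hy
  refine ⟨by rw [map_vd_reschedule]; exact List.nodup_range' .., fun y hy => ?_, fun y hy => ?_⟩
  · exact (List.mem_range'_1.1 (hmem y hy)).1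
  · have := (List.mem_range'_1.1 (hmem y hy)).2
    have := length_ops_le b t S
    omega

lemma countP_eq_of_getElem {α β : Type*} {p : α → Bool} {q : β → Bool} {l : List α} {l' : List β}
    (hlen : l.length = l'.length)
    (h : ∀ i (h₁ : i < l.length) (h₂ : i < l'.length), p l[i] = q l'[i]) :
    l.countP p = l'.countP q := by
  have : l.map p = l'.map q :=
    List.ext_getElem (by simpa using hlen) fun i h1 h2 => by
      simpa using h i (by simpa using h1) (by simpa using h2)
  have h2 := congrArg (List.countP id) this
  simpa [List.countP_map] using h2

/-- The number of packets of value at least `x`. -/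
def heavy (x : ℝ≥0) (Q : List (Item I)) : ℕ := Q.countP fun y => x ≤ I.w y.id

/-- The number of packets whose value is at least the price `m` of their slot `f`, where this price
is at least `x`. The slot is the virtual deadline, except between `OPS` and the assignment of new
virtual deadlines, when it is the latest possible slot of the packet. -/
def paid (x : ℝ≥0) (m : ℕ → ℝ≥0) (f : Item I → ℕ) (Q : List (Item I)) : ℕ :=
  Q.countP fun y => x ≤ m (f y) ∧ m (f y) ≤ I.w y.id

/-- The number of slots in `[t, N)` of price at least `x` that are not used by the reference
schedule, which uses the slots in `B`. -/
def idle (x : ℝ≥0) (t N : ℕ) (m : ℕ → ℝ≥0) (B : Finset ℕ) : ℕ :=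
  ((Finset.Ico t N).filter fun s => s ∉ B ∧ x ≤ m s).card

/-- The contribution of level `x` to the potential, before scaling by the gap of the level. It is
capped by the number of packets that the reference schedule still stores. -/
def levelPot (x : ℝ≥0) (t N : ℕ) (m : ℕ → ℝ≥0) (B : Finset ℕ) (Q : List (Item I)) : ℤ :=
  min (B.card : ℤ) (heavy x Q + paid x m Item.vd Q - idle x t N m B)

lemma heavy_cons (x : ℝ≥0) (y : Item I) (Q : List (Item I)) :
    heavy x (y :: Q) = heavy x Q + if x ≤ I.w y.id then 1 else 0 := by
  simp [heavy, List.countP_cons]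

lemma paid_cons (x : ℝ≥0) (m : ℕ → ℝ≥0) (f : Item I → ℕ) (y : Item I) (Q : List (Item I)) :
    paid x m f (y :: Q) = paid x m f Q + if x ≤ m (f y) ∧ m (f y) ≤ I.w y.id then 1 else 0 := by
  simp [paid, List.countP_cons]

lemma heavy_perm {x : ℝ≥0} {Q Q' : List (Item I)} (h : Q.Perm Q') : heavy x Q = heavy x Q' :=
  h.countP_eq _

lemma paid_perm {x : ℝ≥0} {m : ℕ → ℝ≥0} {f : Item I → ℕ} {Q Q' : List (Item I)}
    (h : Q.Perm Q') : paid x m f Q = paid x m f Q' :=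
  h.countP_eq _

lemma paid_congr {x : ℝ≥0} {m : ℕ → ℝ≥0} {f g : Item I → ℕ} {Q : List (Item I)}
    (h : ∀ y ∈ Q, f y = g y) : paid x m f Q = paid x m g Q :=
  List.countP_congr fun y hy => by rw [h y hy]

lemma Slotted.add_lastSlot {b t : ℕ} {Q : List (Item I)} (h : Slotted b t Q) {y : Item I}
    (hy : y ∈ Q) : t + lastSlot b t y = y.vd := by
  rw [h.lastSlot_eq hy]
  have := h.le_vd y hy
  omega

lemma Slotted.paid_eq {b t : ℕ} {Q : List (Item I)} (h : Slotted b t Q) (x : ℝ≥0)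
    (m : ℕ → ℝ≥0) : paid x m (fun y => t + lastSlot b t y) Q = paid x m Item.vd Q :=
  paid_congr fun _ hy => h.add_lastSlot hy

lemma heavy_reschedule (b t : ℕ) (S : List (Item I)) (x : ℝ≥0) :
    heavy x (reschedule b t S) = heavy x (ops b t S) := by
  refine countP_eq_of_getElem (length_reschedule b t S) fun i h1 h2 => ?_
  rw [getElem_reschedule]

/-- When virtual deadlines are tightened, the prices can be adapted: a slot takes over the price of
the latest slot in which its packet could have been sent. -/
lemma exists_price_reschedule (b t N : ℕ) (S : List (Item I)) (B : Finset ℕ) {m : ℕ → ℝ≥0}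
    (hm : Antitone m) :
    ∃ m' : ℕ → ℝ≥0, Antitone m' ∧
      (∀ x, paid x m' Item.vd (reschedule b t S) =
        paid x m (fun y => t + lastSlot b t y) (ops b t S)) ∧
      ∀ x, 0 < x → idle x t N m' B ≤ idle x t N m B := by
  set R := ops b t S with hR
  let m' : ℕ → ℝ≥0 := fun s =>
    if s < t then m s else if h : s - t < R.length then m (t + lastSlot b t (R[s - t])) else 0
  have hslot : ∀ i (h : i < R.length), i ≤ lastSlot b t R[i] := fun i h => by
    have h1 : t + i ≤ R[i].vd := le_vd_ops_getElem b t S h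
    have h2 := length_ops_le b t S
    unfold lastSlot
    rw [← hR] at h2
    omega
  have hmono : ∀ i j (hj : j < R.length) (hij : i ≤ j),
      lastSlot b t R[i] ≤ lastSlot b t R[j] := fun i j hj hij => by
    rcases hij.eq_or_lt with rfl | hij
    · exact le_rfl
    · have := List.pairwise_iff_getElem.1 (ops_pairwise b t S) i j (hij.trans hj) hj hij
      have : (R[i]'(hij.trans hj)).vd ≤ R[j].vd := this
      unfold lastSlot
      omega
  refine ⟨m', fun s s' hss => ?_, fun x => ?_, fun x hx => ?_⟩
  · simp only [m']
    by_cases h' : s' < t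
    · rw [if_pos h', if_pos (by omega)]
      exact hm hss
    rw [if_neg h']
    by_cases h2 : s' - t < R.length
    · rw [dif_pos h2]
      by_cases h : s < t
      · rw [if_pos h]
        exact hm (by omega)
      · rw [if_neg h, dif_pos (by omega)]
        exact hm (by have := hmono (s - t) (s' - t) h2 (by omega); omega)
    · rw [dif_neg h2]
      exact zero_le
  · refine countP_eq_of_getElem (length_reschedule b t S) fun i h1 h2 => ?_
    rw [getElem_reschedule]
    have : m' (t + i) = m (t + lastSlot b t R[i]) := by
      simp only [m']
      rw [if_neg (by omega)]
      simp [h2]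
    simp only [this]
    rfl
  · refine Finset.card_le_card fun s hs => ?_
    simp only [Finset.mem_filter, Finset.mem_Ico] at hs ⊢
    refine ⟨hs.1, hs.2.1, hs.2.2.trans ?_⟩
    simp only [m']
    rw [if_neg (by omega)]
    split_ifs with h
    · exact hm (by have := hslot _ h; omega)
    · exact zero_le

/-- Prices can be rounded down to levels at which there are enough paid packets. This makes up for
all idle slots without decreasing any contribution to the potential. -/
lemma exists_normal_price (V : Finset ℝ≥0) (t N : ℕ) (B : Finset ℕ) (Q : List (Item I))
    {m : ℕ → ℝ≥0} (hm : Antitone m) :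
    ∃ m' : ℕ → ℝ≥0, Antitone m' ∧ ∀ x ∈ V, 0 < x →
      idle x t N m' B ≤ paid x m' Item.vd Q ∧
      levelPot x t N m B Q ≤ levelPot x t N m' B Q := by
  let G : Finset ℝ≥0 := V.filter fun x => idle x t N m B ≤ paid x m Item.vd Q
  let r : ℝ≥0 → ℝ≥0 := fun v => (G.filter (· ≤ v)).sup id
  have hr_mono : Monotone r := fun u v huv => by
    refine Finset.sup_mono fun x hx => ?_
    rw [Finset.mem_filter] at hx ⊢
    exact ⟨hx.1, hx.2.trans huv⟩
  have hr_le : ∀ v, r v ≤ v := fun v => Finset.sup_le fun x hx => (Finset.mem_filter.1 hx).2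
  have hle_r : ∀ x v, 0 < x → (x ≤ r v ↔ ∃ u ∈ G, x ≤ u ∧ u ≤ v) := fun x v hx => by
    simp only [r]
    rw [Finset.le_sup_iff (by simpa using hx)]
    simp only [Finset.mem_filter, id]
    exact ⟨fun ⟨u, ⟨h1, h2⟩, h3⟩ => ⟨u, h1, h3, h2⟩, fun ⟨u, h1, h2, h3⟩ => ⟨u, ⟨h1, h3⟩, h2⟩⟩
  refine ⟨r ∘ m, fun s s' h => hr_mono (hm h), fun x hxV hx => ?_⟩
  by_cases hex : (G.filter (x ≤ ·)).Nonempty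
  · -- the least good level above `x` plays the role of `x`
    obtain ⟨u, hu, humin⟩ := (G.filter (x ≤ ·)).exists_min_image id hex
    obtain ⟨huG, hxu⟩ := Finset.mem_filter.1 hu
    have hiff : ∀ v, x ≤ r v ↔ u ≤ v := fun v => by
      rw [hle_r x v hx]
      refine ⟨fun ⟨u', h1, h2, h3⟩ => ?_, fun h => ⟨u, huG, hxu, h⟩⟩
      exact (humin u' (Finset.mem_filter.2 ⟨h1, h2⟩)).trans h3
    have h1 : idle x t N (r ∘ m) B = idle u t N m B := by
      unfold idle
      congr 1
      ext s
      simp only [Finset.mem_filter, Function.comp_apply, hiff]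
    have h2 : paid u m Item.vd Q ≤ paid x (r ∘ m) Item.vd Q := by
      refine List.countP_mono_left fun y _ hy => ?_
      simp only [decide_eq_true_eq, Function.comp_apply, hiff] at hy ⊢
      exact ⟨hy.1, (hr_le _).trans hy.2⟩
    have h3 := (Finset.mem_filter.1 huG).2
    refine ⟨by omega, ?_⟩
    by_cases hxG : idle x t N m B ≤ paid x m Item.vd Q
    · obtain rfl : u = x :=
        le_antisymm (humin x (Finset.mem_filter.2
          ⟨Finset.mem_filter.2 ⟨hxV, hxG⟩, le_rfl⟩)) hxu
      unfold levelPot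
      omega
    · unfold levelPot
      omega
  · have hno : ∀ v, ¬ x ≤ r v := fun v h => by
      obtain ⟨u, h1, h2, -⟩ := (hle_r x v hx).1 h
      exact hex ⟨u, Finset.mem_filter.2 ⟨h1, h2⟩⟩
    have h1 : idle x t N (r ∘ m) B = 0 := by
      unfold idle
      rw [Finset.card_eq_zero, Finset.filter_eq_empty_iff]
      exact fun s _ h => hno _ h.2
    have h2 : ¬ idle x t N m B ≤ paid x m Item.vd Q := fun h =>
      hex ⟨x, Finset.mem_filter.2 ⟨Finset.mem_filter.2 ⟨hxV, h⟩, le_rfl⟩⟩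
    refine ⟨by omega, ?_⟩
    unfold levelPot
    omega

/-! ### Arrival of a packet -/

lemma countP_add_countP_le {α : Type*} {p q r : α → Prop} [DecidablePred p] [DecidablePred q]
    [DecidablePred r] {l : List α} (hp : ∀ y ∈ l, p y → r y ∧ ¬ q y) (hq : ∀ y ∈ l, q y → r y) :
    l.countP (fun y => p y) + l.countP (fun y => q y) ≤ l.countP fun y => r y := by
  induction l with
  | nil => simp
  | cons x l ih =>
    have h := ih (fun y hy => hp y (by simp [hy])) fun y hy => hq y (by simp [hy])
    have hp := hp x (by simp)
    have hq := hq x (by simp)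
    simp only [List.countP_cons, decide_eq_true_eq]
    split_ifs <;> first | omega | tauto

/-- The prices `m`, raised to at least `v` in the slots up to `c`. -/
def raise (m : ℕ → ℝ≥0) (c : ℕ) (v : ℝ≥0) (s : ℕ) : ℝ≥0 := if s ≤ c then max (m s) v else m s

lemma antitone_raise {m : ℕ → ℝ≥0} (hm : Antitone m) (c : ℕ) (v : ℝ≥0) :
    Antitone (raise m c v) := fun s s' h => by
  unfold raise
  split_ifs
  · exact max_le_max_right _ (hm h)
  · omega
  · exact (hm h).trans (le_max_left _ _)
  · exact hm h

/-- The slots up to `c` of price less than `x`. -/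
def cheap (x : ℝ≥0) (t N : ℕ) (m : ℕ → ℝ≥0) (c : ℕ) : Finset ℕ :=
  (Finset.Ico t N).filter fun s => s ≤ c ∧ m s < x

/-- Raising prices to `v` turns the packets in the cheap slots into paid ones. -/
lemma paid_add_cheap_le {x v : ℝ≥0} {t N c : ℕ} {m : ℕ → ℝ≥0} {Q : List (Item I)} (hx : x ≤ v)
    (hheavy : ∀ y ∈ Q, y.vd ≤ c → v ≤ I.w y.id) (hfull : ∀ s, t ≤ s → s ≤ c → ∃ y ∈ Q, y.vd = s) :
    paid x m Item.vd Q + (cheap x t N m c).card ≤ paid x (raise m c v) Item.vd Q := by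
  have h1 : (cheap x t N m c).card ≤ Q.countP fun y => y.vd ≤ c ∧ m y.vd < x := by
    have hsub : cheap x t N m c ⊆
        ((Q.filter fun y => y.vd ≤ c ∧ m y.vd < x).map Item.vd).toFinset := fun s hs => by
      simp only [cheap, Finset.mem_filter, Finset.mem_Ico] at hs
      obtain ⟨y, hy, rfl⟩ := hfull s hs.1.1 hs.2.1
      simp only [List.mem_toFinset, List.mem_map, List.mem_filter, decide_eq_true_eq]
      exact ⟨y, ⟨hy, hs.2⟩, rfl⟩
    refine (Finset.card_le_card hsub).trans ((List.toFinset_card_le _).trans ?_)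
    rw [List.length_map, List.countP_eq_length_filter]
  refine (Nat.add_le_add_left h1 _).trans (countP_add_countP_le (fun y hy h => ?_) fun y hy h => ?_)
  · refine ⟨?_, fun h' => absurd h.1 h'.2.not_ge⟩
    unfold raise
    split_ifs with hc
    · exact ⟨h.1.trans (le_max_left _ _), max_le h.2 (hheavy y hy hc)⟩
    · exact h
  · unfold raise
    rw [if_pos h.1]
    exact ⟨hx.trans (le_max_right _ _), max_le ((h.2.le.trans hx).trans (hheavy y hy h.1))
      (hheavy y hy h.1)⟩

lemma raise_of_lt {m : ℕ → ℝ≥0} {c s : ℕ} {v : ℝ≥0} (h : v < raise m c v s) :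
    raise m c v s = m s := by
  unfold raise at h ⊢
  split_ifs at h ⊢ with hc
  · exact max_eq_left ((lt_max_iff.1 h).resolve_right (lt_irrefl v)).le
  · rfl

/-- The slots used by the reference schedule, after one more slot may have become known. -/
def insertSlot (o : Option ℕ) (B : Finset ℕ) : Finset ℕ := o.elim B (insert · B)

lemma subset_insertSlot (o : Option ℕ) (B : Finset ℕ) : B ⊆ insertSlot o B := by
  cases o
  · exact subset_rfl
  · exact Finset.subset_insert _ _

lemma card_insertSlot {o : Option ℕ} {B : Finset ℕ} (h : ∀ s ∈ o, s ∉ B) :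
    (insertSlot o B).card = B.card + if o.isSome then 1 else 0 := by
  cases o
  · simp [insertSlot]
  · simp [insertSlot, Finset.card_insert_of_notMem (h _ rfl)]

lemma idle_anti {x : ℝ≥0} {t N : ℕ} {m m' : ℕ → ℝ≥0} {B B' : Finset ℕ} (hB : B ⊆ B')
    (hm : ∀ s, x ≤ m' s → x ≤ m s) : idle x t N m' B' ≤ idle x t N m B := by
  refine Finset.card_le_card fun s hs => ?_
  simp only [Finset.mem_filter] at hs ⊢
  exact ⟨hs.1, fun h => hs.2.1 (hB h), hm s hs.2.2⟩

lemma idle_raise_add_le {x v : ℝ≥0} {t N c : ℕ} {m : ℕ → ℝ≥0} {B : Finset ℕ}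
    {o : Option ℕ} (ho : ∀ s ∈ o, t ≤ s ∧ s < N ∧ s ∉ B) :
    idle x t N (raise m c v) (insertSlot o B) + (if ∃ s ∈ o, s ≤ c then 1 else 0) ≤
      idle x t N m B + (cheap x t N m c).card := by
  have hsub : ((Finset.Ico t N).filter fun s => s ∉ insertSlot o B ∧ x ≤ raise m c v s) ⊆
      ((Finset.Ico t N).filter fun s => s ∉ B ∧ x ≤ m s) ∪ cheap x t N m c := fun s hs => by
    simp only [cheap, Finset.mem_union, Finset.mem_filter] at hs ⊢
    by_cases h : x ≤ m s
    · exact .inl ⟨hs.1, fun h => hs.2.1 (subset_insertSlot o B h), h⟩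
    · refine .inr ⟨hs.1, ?_, not_le.1 h⟩
      by_contra hc
      rw [raise, if_neg hc] at hs
      exact h hs.2.2
  split_ifs with h
  · obtain ⟨s, hs, hsc⟩ := h
    obtain ⟨h1, h2, h3⟩ := ho s hs
    obtain rfl : o = some s := hs
    rw [idle, ← Finset.card_insert_of_notMem (a := s) (by simp [insertSlot])]
    refine (Finset.card_le_card (Finset.insert_subset ?_ hsub)).trans (Finset.card_union_le _ _)
    simp only [cheap, Finset.mem_union, Finset.mem_filter, Finset.mem_Ico]
    by_cases h : x ≤ m s
    · exact .inl ⟨⟨h1, h2⟩, h3, h⟩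
    · exact .inr ⟨⟨h1, h2⟩, hsc, not_le.1 h⟩
  · exact (Finset.card_le_card hsub).trans (Finset.card_union_le _ _)

/-- The effect of `OPS` on the potential when the packet `p` arrives. If the reference schedule
sends `p` in some slot, each level up to the value of `p` gains one. -/
lemma exists_price_ops {b t N : ℕ} (hb : 0 < b) {Q : List (Item I)} (hQ : Slotted b t Q)
    (p : Item I) {B : Finset ℕ} {o : Option ℕ}
    (ho : ∀ s ∈ o, t ≤ s ∧ s < N ∧ s ∉ B) (hop : ∀ s ∈ o, s ≤ p.vd)
    (hcard : (insertSlot o B).card ≤ b) {m : ℕ → ℝ≥0} (hm : Antitone m) :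
    ∃ m' : ℕ → ℝ≥0, Antitone m' ∧ ∀ x, idle x t N m B ≤ paid x m Item.vd Q →
      idle x t N m' (insertSlot o B) ≤
        paid x m' (fun y => t + lastSlot b t y) (ops b t (p :: Q)) ∧
      levelPot x t N m B Q + (if o.isSome ∧ x ≤ I.w p.id then 1 else 0) ≤
        min ((insertSlot o B).card : ℤ) (heavy x (ops b t (p :: Q)) +
          paid x m' (fun y => t + lastSlot b t y) (ops b t (p :: Q)) -
          idle x t N m' (insertSlot o B)) := by
  have hBcard := card_insertSlot (o := o) (B := B) fun s hs => (ho s hs).2.2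
  rcases hQ.ops_cons hb p with h | ⟨hpt, h⟩ | ⟨z, h, hpt, hzp, hslot, hz⟩
  · refine ⟨m, hm, fun x hx => ?_⟩
    have h1 := idle_anti (x := x) (t := t) (N := N) (m := m) (subset_insertSlot o B)
      fun s hs => hs
    rw [paid_perm h, heavy_perm h, paid_cons, heavy_cons, hQ.paid_eq]
    unfold levelPot
    split_ifs at * <;> first | omega | tauto
  · refine ⟨m, hm, fun x hx => ?_⟩
    -- the reference schedule cannot send an expired packet either
    have ho' : o = none := by
      cases o with
      | none => rfl
      | some s =>
        have := ho s rfl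
        have := hop s rfl
        omega
    subst ho'
    rw [paid_perm h, heavy_perm h, hQ.paid_eq]
    exact ⟨hx, by simp [levelPot, insertSlot]⟩
  · set c := t + lastSlot b t p with hc
    refine ⟨raise m c (I.w z.id), antitone_raise hm _ _, fun x hx => ?_⟩
    have hheavy : ∀ y ∈ Q, y.vd ≤ c → I.w z.id ≤ I.w y.id := fun y hy hyc => by
      obtain ⟨y', hy', h1, h2⟩ := hz y.vd (hQ.le_vd y hy) hyc
      rwa [List.inj_on_of_nodup_map hQ.nodup hy' hy h1] at h2
    have hq := heavy_perm (x := x) h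
    have hg := paid_perm (x := x) (m := raise m c (I.w z.id))
      (f := fun y => t + lastSlot b t y) h
    rw [heavy_cons, heavy_cons] at hq
    rw [paid_cons, paid_cons, hQ.paid_eq] at hg
    have hraise : ∀ s ≤ c, I.w z.id ≤ raise m c (I.w z.id) s := fun s hs => by
      rw [raise, if_pos hs]
      exact le_max_right _ _
    -- if `z` is paid then so is `p`, hence exchanging them loses no paid packet
    have hpaid : paid x (raise m c (I.w z.id)) Item.vd Q ≤
        paid x (raise m c (I.w z.id)) (fun y => t + lastSlot b t y) (ops b t (p :: Q)) := by
      have : (x ≤ raise m c (I.w z.id) (t + lastSlot b t z) ∧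
          raise m c (I.w z.id) (t + lastSlot b t z) ≤ I.w z.id) →
          (x ≤ raise m c (I.w z.id) (t + lastSlot b t p) ∧
          raise m c (I.w z.id) (t + lastSlot b t p) ≤ I.w p.id) := fun ⟨h1, h2⟩ =>
        ⟨(h1.trans h2).trans (hraise _ le_rfl),
          ((antitone_raise hm c _ (by omega : t + lastSlot b t z ≤ t + lastSlot b t p)).trans
            h2).trans hzp⟩
      split_ifs at hg <;> first | omega | tauto
    by_cases hxz : x ≤ I.w z.id
    · have hxp := hxz.trans hzp
      rw [if_pos hxz, if_pos hxp] at hq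
      have h1 := paid_add_cheap_le (N := N) (m := m) hxz hheavy
        fun s h1 h2 => (hz s h1 h2).imp fun y hy => ⟨hy.1, hy.2.1⟩
      have h2 := idle_raise_add_le (x := x) (v := I.w z.id) (c := c) (m := m) ho
      refine ⟨by omega, ?_⟩
      unfold levelPot
      by_cases hoc : ∃ s ∈ o, s ≤ c
      · rw [if_pos hoc] at h2
        obtain ⟨s, hs, -⟩ := hoc
        obtain rfl : o = some s := hs
        simp only [Option.isSome_some, hxp, and_self, if_true] at *
        omega
      rw [if_neg hoc] at h2
      cases o with
      | none =>
        simp only [Option.isSome_none, Bool.false_eq_true, false_and, if_false] at *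
        omega
      | some s =>
        -- all slots are in use by packets of value at least `x`
        have hfull : b ≤ heavy x Q := by
          have hsc : ¬ s ≤ c := fun h => hoc ⟨s, rfl, h⟩
          have hsp := hop s rfl
          have hcb : c = t + (b - 1) := by
            unfold lastSlot at hc
            omega
          have hsub : Finset.Ico t (t + b) ⊆
              ((Q.filter fun y => x ≤ I.w y.id).map Item.vd).toFinset := fun s hs => by
            rw [Finset.mem_Ico] at hs
            obtain ⟨y, hy, rfl, h3⟩ := hz s hs.1 (by omega)
            simp only [List.mem_toFinset, List.mem_map, List.mem_filter, decide_eq_true_eq]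
            exact ⟨y, ⟨hy, hxz.trans h3⟩, rfl⟩
          have := (Finset.card_le_card hsub).trans (List.toFinset_card_le _)
          rw [List.length_map, ← List.countP_eq_length_filter, Nat.card_Ico] at this
          unfold heavy
          omega
        simp only [Option.isSome_some, hxp, and_self, if_true] at *
        omega
    · rw [if_neg hxz] at hq
      rw [not_le] at hxz
      have h1 : paid x m Item.vd Q ≤ paid x (raise m c (I.w z.id)) Item.vd Q := by
        refine List.countP_mono_left fun y _ hy => ?_
        simp only [decide_eq_true_eq] at hy ⊢
        have : raise m c (I.w z.id) y.vd = m y.vd := by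
          unfold raise
          split_ifs
          · exact max_eq_left (hxz.le.trans hy.1)
          · rfl
        rwa [this]
      have h2 := idle_anti (x := x) (t := t) (N := N) (m := m) (m' := raise m c (I.w z.id))
        (subset_insertSlot o B) fun s hs => by rwa [raise_of_lt (hxz.trans_le hs)] at hs
      refine ⟨by omega, ?_⟩
      unfold levelPot
      split_ifs at * <;> first | omega | tauto

/-- The arrival of a packet: the potential grows by the value of the packet if the reference
schedule sends it. -/
lemma exists_price_arrival {b t N : ℕ} (hb : 0 < b) {Q : List (Item I)} (hQ : Slotted b t Q)
    (p : Item I) {B : Finset ℕ} {o : Option ℕ}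
    (ho : ∀ s ∈ o, t ≤ s ∧ s < N ∧ s ∉ B) (hop : ∀ s ∈ o, s ≤ p.vd)
    (hcard : (insertSlot o B).card ≤ b) {m : ℕ → ℝ≥0} (hm : Antitone m) :
    ∃ m' : ℕ → ℝ≥0, Antitone m' ∧ ∀ x, 0 < x → idle x t N m B ≤ paid x m Item.vd Q →
      idle x t N m' (insertSlot o B) ≤ paid x m' Item.vd (reschedule b t (p :: Q)) ∧
      levelPot x t N m B Q + (if o.isSome ∧ x ≤ I.w p.id then 1 else 0) ≤
        levelPot x t N m' (insertSlot o B) (reschedule b t (p :: Q)) := by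
  obtain ⟨m₁, hm₁, h1⟩ := exists_price_ops hb hQ p ho hop hcard hm
  obtain ⟨m₂, hm₂, h2, h3⟩ := exists_price_reschedule b t N (p :: Q) (insertSlot o B) hm₁
  refine ⟨m₂, hm₂, fun x hx hxm => ?_⟩
  obtain ⟨h4, h5⟩ := h1 x hxm
  have h6 := h3 x hx
  unfold levelPot at h5 ⊢
  rw [h2, heavy_reschedule]
  refine ⟨by omega, ?_⟩
  omega

/-- Rescheduling without an arriving packet does not decrease the potential. -/
lemma exists_price_reschedule_slotted {b t N : ℕ} (hb : 0 < b) {Q : List (Item I)}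
    (hQ : Slotted b t Q) {B : Finset ℕ} {m : ℕ → ℝ≥0} (hm : Antitone m) :
    ∃ m' : ℕ → ℝ≥0, Antitone m' ∧ ∀ x, 0 < x →
      levelPot x t N m B Q ≤ levelPot x t N m' B (reschedule b t Q) := by
  obtain ⟨m₂, hm₂, h2, h3⟩ := exists_price_reschedule b t N Q B hm
  refine ⟨m₂, hm₂, fun x hx => ?_⟩
  have h6 := h3 x hx
  unfold levelPot
  rw [h2, heavy_reschedule, heavy_perm (hQ.ops_perm hb), paid_perm (hQ.ops_perm hb), hQ.paid_eq]
  omega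

/-! ### Delivery of a packet -/

lemma idle_eq_succ {x : ℝ≥0} {t N : ℕ} (ht : t < N) (m : ℕ → ℝ≥0) (B : Finset ℕ) :
    idle x t N m B =
      idle x (t + 1) N m (B.erase t) + if t ∉ B ∧ x ≤ m t then 1 else 0 := by
  have h1 : Finset.Ico t N = insert t (Finset.Ico (t + 1) N) := by
    ext s
    simp only [Finset.mem_insert, Finset.mem_Ico]
    omega
  have h2 : ((Finset.Ico (t + 1) N).filter fun s => s ∉ B ∧ x ≤ m s) =
      (Finset.Ico (t + 1) N).filter fun s => s ∉ B.erase t ∧ x ≤ m s := by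
    refine Finset.filter_congr fun s hs => ?_
    have : s ≠ t := by
      have := (Finset.mem_Ico.1 hs).1
      omega
    simp [this]
  unfold idle
  rw [h1, Finset.filter_insert, h2]
  split_ifs
  · rw [Finset.card_insert_of_notMem (by simp)]
  · rfl

lemma card_erase_add (t : ℕ) (B : Finset ℕ) :
    (B.erase t).card + (if t ∈ B then 1 else 0) = B.card := by
  split_ifs with h
  · exact Finset.card_erase_add_one h
  · rw [Finset.erase_eq_of_notMem h, add_zero]

lemma heavy_eq_zero {x : ℝ≥0} {Q : List (Item I)} (h : ∀ y ∈ Q, I.w y.id < x) : heavy x Q = 0 := by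
  simpa [heavy, List.countP_eq_zero] using h

lemma paid_le_heavy (x : ℝ≥0) (m : ℕ → ℝ≥0) (f : Item I → ℕ) (Q : List (Item I)) :
    paid x m f Q ≤ heavy x Q := by
  refine List.countP_mono_left fun y _ hy => ?_
  simp only [decide_eq_true_eq] at hy ⊢
  exact hy.1.trans hy.2

lemma paid_eq_zero {x : ℝ≥0} {m : ℕ → ℝ≥0} {f : Item I → ℕ} {Q : List (Item I)}
    (h : ∀ y ∈ Q, m (f y) < x) : paid x m f Q = 0 := by
  simp only [paid, List.countP_eq_zero, decide_eq_true_eq, not_and]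
  exact fun y hy h' => absurd h' (h y hy).not_ge

lemma idle_eq_zero {x : ℝ≥0} {t N : ℕ} {m : ℕ → ℝ≥0} {B : Finset ℕ} (hm : Antitone m)
    (h : m t < x) : idle x t N m B = 0 := by
  unfold idle
  rw [Finset.card_eq_zero, Finset.filter_eq_empty_iff]
  exact fun s hs h' => absurd h'.2 ((hm (Finset.mem_Ico.1 hs).1).trans_lt h).not_ge

/-- No packet in the buffer: a step without delivery. -/
lemma levelPot_nil_le {x : ℝ≥0} {t N : ℕ} (ht : t < N) (m : ℕ → ℝ≥0) (B : Finset ℕ) :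
    levelPot x t N m B ([] : List (Item I)) ≤
      levelPot x (t + 1) N m (B.erase t) ([] : List (Item I)) := by
  have h1 := idle_eq_succ (x := x) ht m B
  have h2 : heavy x ([] : List (Item I)) = 0 := rfl
  have h3 : paid x m Item.vd ([] : List (Item I)) = 0 := rfl
  unfold levelPot
  omega

section Deliver

variable {x v : ℝ≥0} {t N : ℕ} {m : ℕ → ℝ≥0} {B : Finset ℕ} {e h : Item I} {Q : List (Item I)}

/-- Sending the earliest packet `e` while the prices stay. -/
lemma levelPot_send_first_le (ht : t < N) (he : e.vd = t) (hev : I.w e.id ≤ v)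
    (hv : ∀ y ∈ Q, I.w y.id ≤ v) :
    levelPot x t N m B (e :: Q) ≤ levelPot x (t + 1) N m (B.erase t) Q +
      ((if x ≤ I.w e.id then 1 else 0) + if x ≤ v then 1 else 0) := by
  have h1 := idle_eq_succ (x := x) ht m B
  have h2 := card_erase_add t B
  have h3 := heavy_cons x e Q
  have h4 := paid_cons x m Item.vd e Q
  rw [he] at h4
  unfold levelPot
  by_cases hxv : x ≤ v
  · grind
  · have h5 : heavy x Q = 0 := heavy_eq_zero fun y hy => (hv y hy).trans_lt (not_le.1 hxv)
    have h6 := paid_le_heavy x m Item.vd Q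
    have hxe : ¬ x ≤ I.w e.id := fun h => hxv (h.trans hev)
    have : ¬ (x ≤ m t ∧ m t ≤ I.w e.id) := fun h => hxe (h.1.trans h.2)
    rw [if_neg hxe] at h3 ⊢
    rw [if_neg this] at h4
    grind

/-- Sending the earliest packet `e` while the prices stay, if `e` is worth less than the price of
its slot. -/
lemma levelPot_send_first_le_of_lt (ht : t < N) (he : e.vd = t) (hem : I.w e.id < m t)
    (hev : I.w e.id ≤ v) (hv : ∀ y ∈ Q, I.w y.id ≤ v) :
    levelPot x t N m B (e :: Q) ≤ levelPot x (t + 1) N m (B.erase t) Q +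
      if x ≤ v then 1 else 0 := by
  have h1 := idle_eq_succ (x := x) ht m B
  have h2 := card_erase_add t B
  have h3 := heavy_cons x e Q
  have h4 := paid_cons x m Item.vd e Q
  rw [he, if_neg fun h => hem.not_ge h.2] at h4
  unfold levelPot
  by_cases hxv : x ≤ v
  · by_cases hxe : x ≤ I.w e.id
    · have hxm := hxe.trans hem.le
      grind
    · grind
  · have h5 : heavy x Q = 0 := heavy_eq_zero fun y hy => (hv y hy).trans_lt (not_le.1 hxv)
    have h6 := paid_le_heavy x m Item.vd Q
    have hxe : ¬ x ≤ I.w e.id := fun h => hxv (h.trans hev)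
    rw [if_neg hxe] at h3
    grind

/-- Sending the best packet `h` while the prices stay, if the earliest packet `e`, which expires, is
worth less than the price of its slot. -/
lemma levelPot_send_best_le_of_lt (ht : t < N) (he : e.vd = t) (hem : I.w e.id < m t)
    (hev : I.w e.id ≤ I.w h.id) (hh : h ∈ Q) (hv : ∀ y ∈ Q, I.w y.id ≤ I.w h.id) :
    levelPot x t N m B (e :: Q) ≤ levelPot x (t + 1) N m (B.erase t) (Q.erase h) +
      ((if x ≤ I.w e.id then 1 else 0) + 2 * if x ≤ I.w h.id then 1 else 0) := by
  have h1 := idle_eq_succ (x := x) ht m B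
  have h2 := card_erase_add t B
  have h3 := heavy_cons x e Q
  have h4 := paid_cons x m Item.vd e Q
  rw [he, if_neg fun h => hem.not_ge h.2] at h4
  have h5 := heavy_perm (x := x) (List.perm_cons_erase hh)
  rw [heavy_cons] at h5
  have h6 := paid_perm (x := x) (m := m) (f := Item.vd) (List.perm_cons_erase hh)
  rw [paid_cons] at h6
  unfold levelPot
  by_cases hxh : x ≤ I.w h.id
  · grind
  · have h7 : heavy x Q = 0 := heavy_eq_zero fun y hy => (hv y hy).trans_lt (not_le.1 hxh)
    have h8 := paid_le_heavy x m Item.vd Q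
    have hxe : ¬ x ≤ I.w e.id := fun h => hxh (h.trans hev)
    rw [if_neg hxe] at h3
    grind

/-- The number of packets that are worth more than `e`. -/
def better (e : Item I) (Q : List (Item I)) : ℕ := Q.countP fun y => I.w e.id < I.w y.id

lemma better_le_heavy (hx : x ≤ I.w e.id) : better e Q ≤ heavy x Q := by
  refine List.countP_mono_left fun y _ hy => ?_
  simp only [decide_eq_true_eq] at hy ⊢
  exact hx.trans hy.le

lemma heavy_le_better (hx : I.w e.id < x) : heavy x Q ≤ better e Q := by
  refine List.countP_mono_left fun y _ hy => ?_
  simp only [decide_eq_true_eq] at hy ⊢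
  exact hx.trans_le hy

/-- Sending the earliest packet while the prices stay, if it is worth the price of its slot and few
packets are better. -/
lemma levelPot_send_first_le_of_better_lt (ht : t < N) (he : e.vd = t) (hm : Antitone m)
    (hem : m t ≤ I.w e.id) (hQ : ∀ y ∈ Q, t ≤ y.vd) (hb : better e Q < B.card) :
    levelPot x t N m B (e :: Q) ≤ levelPot x (t + 1) N m (B.erase t) Q +
      2 * if x ≤ I.w e.id then 1 else 0 := by
  have h1 := idle_eq_succ (x := x) ht m B
  have h2 := card_erase_add t B
  have h3 := heavy_cons x e Q
  have h4 := paid_cons x m Item.vd e Q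
  rw [he] at h4
  unfold levelPot
  by_cases hxe : x ≤ I.w e.id
  · grind
  · rw [if_neg hxe] at h3 ⊢
    rw [not_le] at hxe
    have h5 : idle x t N m B = 0 := idle_eq_zero hm (hem.trans_lt hxe)
    have h6 : paid x m Item.vd (e :: Q) = 0 := paid_eq_zero fun y hy => by
      refine (hm (?_ : t ≤ y.vd)).trans_lt (hem.trans_lt hxe)
      rcases List.mem_cons.1 hy with rfl | hy
      exacts [he.ge, hQ y hy]
    have h7 := heavy_le_better (Q := Q) hxe
    grind

/-- Sending the best packet while the prices stay, if the earliest packet is worth the price of its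
slot and few packets are better. -/
lemma levelPot_send_best_le_of_better_lt (ht : t < N) (he : e.vd = t) (hm : Antitone m)
    (hem : m t ≤ I.w e.id) (hQ : ∀ y ∈ Q, t ≤ y.vd) (hb : better e Q < B.card)
    (hev : I.w e.id ≤ I.w h.id) (hh : h ∈ Q) :
    levelPot x t N m B (e :: Q) ≤ levelPot x (t + 1) N m (B.erase t) (Q.erase h) +
      (3 * (if x ≤ I.w e.id then 1 else 0) + if x ≤ I.w h.id then 1 else 0) := by
  have h1 := idle_eq_succ (x := x) ht m B
  have h2 := card_erase_add t B
  have h3 := heavy_cons x e Q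
  have h4 := paid_cons x m Item.vd e Q
  rw [he] at h4
  have h5 := heavy_perm (x := x) (List.perm_cons_erase hh)
  rw [heavy_cons] at h5
  have h6 := paid_perm (x := x) (m := m) (f := Item.vd) (List.perm_cons_erase hh)
  rw [paid_cons] at h6
  unfold levelPot
  by_cases hxe : x ≤ I.w e.id
  · have hxh := hxe.trans hev
    grind
  · rw [if_neg hxe] at h3 ⊢
    rw [not_le] at hxe
    have h7 : idle x t N m B = 0 := idle_eq_zero hm (hem.trans_lt hxe)
    have h8 : paid x m Item.vd (e :: Q) = 0 := paid_eq_zero fun y hy => by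
      refine (hm (?_ : t ≤ y.vd)).trans_lt (hem.trans_lt hxe)
      rcases List.mem_cons.1 hy with rfl | hy
      exacts [he.ge, hQ y hy]
    have h9 := heavy_le_better (Q := Q) hxe
    grind

lemma levelPot_zero (hx : 0 < x) (t N : ℕ) (B : Finset ℕ) (Q : List (Item I)) :
    levelPot x t N 0 B Q = min (B.card : ℤ) (heavy x Q) := by
  have h1 : idle x t N 0 B = 0 := idle_eq_zero (fun _ _ _ => le_rfl) hx
  have h2 : paid x 0 Item.vd Q = 0 := paid_eq_zero fun y _ => hx
  unfold levelPot
  rw [h1, h2]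
  simp

/-- If many packets are better than the earliest packet, which is worth the price of its slot, then
all prices can be set to zero when the earliest packet is sent. -/
lemma levelPot_send_first_le_of_le_better (hx : 0 < x) (he : e.vd = t) (hm : Antitone m)
    (hem : m t ≤ I.w e.id) (hQ : ∀ y ∈ Q, t ≤ y.vd) (hb : B.card ≤ better e Q)
    (hev : I.w e.id ≤ v) (hv : ∀ y ∈ Q, I.w y.id ≤ v) :
    levelPot x t N m B (e :: Q) ≤ levelPot x (t + 1) N 0 (B.erase t) Q +
      if x ≤ v then 1 else 0 := by
  have h2 := card_erase_add t B
  have h3 := heavy_cons x e Q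
  rw [levelPot_zero hx]
  unfold levelPot
  by_cases hxe : x ≤ I.w e.id
  · have := better_le_heavy (Q := Q) hxe
    rw [if_pos (hxe.trans hev)]
    grind
  · rw [if_neg hxe] at h3
    rw [not_le] at hxe
    have h5 : idle x t N m B = 0 := idle_eq_zero hm (hem.trans_lt hxe)
    have h6 : paid x m Item.vd (e :: Q) = 0 := paid_eq_zero fun y hy => by
      refine (hm (?_ : t ≤ y.vd)).trans_lt (hem.trans_lt hxe)
      rcases List.mem_cons.1 hy with rfl | hy
      exacts [he.ge, hQ y hy]
    by_cases hxv : x ≤ v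
    · grind
    · have h5 : heavy x Q = 0 := heavy_eq_zero fun y hy => (hv y hy).trans_lt (not_le.1 hxv)
      grind

/-- If many packets are better than the earliest packet, which is worth the price of its slot, then
all prices can be set to zero when the best packet is sent. -/
lemma levelPot_send_best_le_of_le_better (hx : 0 < x) (he : e.vd = t) (hm : Antitone m)
    (hem : m t ≤ I.w e.id) (hQ : ∀ y ∈ Q, t ≤ y.vd) (hb : B.card ≤ better e Q)
    (hev : I.w e.id ≤ I.w h.id) (hh : h ∈ Q) (hv : ∀ y ∈ Q, I.w y.id ≤ I.w h.id) :
    levelPot x t N m B (e :: Q) ≤ levelPot x (t + 1) N 0 (B.erase t) (Q.erase h) +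
      if x ≤ I.w h.id then 1 else 0 := by
  have h2 := card_erase_add t B
  have h3 := heavy_cons x e Q
  have h4 := heavy_perm (x := x) (List.perm_cons_erase hh)
  rw [heavy_cons] at h4
  rw [levelPot_zero hx]
  unfold levelPot
  by_cases hxe : x ≤ I.w e.id
  · have := better_le_heavy (Q := Q) hxe
    rw [if_pos (hxe.trans hev)]
    grind
  · rw [if_neg hxe] at h3
    rw [not_le] at hxe
    have h5 : idle x t N m B = 0 := idle_eq_zero hm (hem.trans_lt hxe)
    have h6 : paid x m Item.vd (e :: Q) = 0 := paid_eq_zero fun y hy => by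
      refine (hm (?_ : t ≤ y.vd)).trans_lt (hem.trans_lt hxe)
      rcases List.mem_cons.1 hy with rfl | hy
      exacts [he.ge, hQ y hy]
    by_cases hxh : x ≤ I.w h.id
    · grind
    · have h5 : heavy x Q = 0 := heavy_eq_zero fun y hy => (hv y hy).trans_lt (not_le.1 hxh)
      grind

/-- The loss of potential in a step in which the earliest packet `e` or the best packet `h` may be
sent, as multiples of their values. -/
lemma exists_price_deliver (ht : t < N) (he : e.vd = t) (hm : Antitone m)
    (hQ : ∀ y ∈ Q, t ≤ y.vd) (hev : I.w e.id ≤ I.w h.id) (hh : h ∈ Q)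
    (hv : ∀ y ∈ Q, I.w y.id ≤ I.w h.id) :
    ∃ m₁ m₂ : ℕ → ℝ≥0, Antitone m₁ ∧ Antitone m₂ ∧ ∃ a₁ c₁ a₂ c₂ : ℕ,
      ((a₁, c₁, a₂, c₂) = (0, 1, 1, 2) ∨ (a₁, c₁, a₂, c₂) = (2, 0, 3, 1) ∨
        (a₁, c₁, a₂, c₂) = (0, 1, 0, 1)) ∧
      ∀ x, 0 < x →
        levelPot x t N m B (e :: Q) ≤ levelPot x (t + 1) N m₁ (B.erase t) Q +
          (a₁ * (if x ≤ I.w e.id then 1 else 0) + c₁ * if x ≤ I.w h.id then 1 else 0) ∧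
        levelPot x t N m B (e :: Q) ≤ levelPot x (t + 1) N m₂ (B.erase t) (Q.erase h) +
          (a₂ * (if x ≤ I.w e.id then 1 else 0) + c₂ * if x ≤ I.w h.id then 1 else 0) := by
  by_cases hem : I.w e.id < m t
  · refine ⟨m, m, hm, hm, 0, 1, 1, 2, .inl rfl, fun x hx => ⟨?_, ?_⟩⟩
    · simpa using levelPot_send_first_le_of_lt ht he hem hev hv
    · simpa using levelPot_send_best_le_of_lt ht he hem hev hh hv
  rw [not_lt] at hem
  by_cases hb : better e Q < B.card
  · refine ⟨m, m, hm, hm, 2, 0, 3, 1, .inr (.inl rfl), fun x hx => ⟨?_, ?_⟩⟩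
    · simpa using levelPot_send_first_le_of_better_lt ht he hm hem hQ hb
    · simpa using levelPot_send_best_le_of_better_lt ht he hm hem hQ hb hev hh
  · rw [not_lt] at hb
    refine ⟨0, 0, fun _ _ _ => le_rfl, fun _ _ _ => le_rfl, 0, 1, 0, 1, .inr (.inr rfl),
      fun x hx => ⟨?_, ?_⟩⟩
    · simpa using levelPot_send_first_le_of_le_better hx he hm hem hQ hb hev hv
    · simpa using levelPot_send_best_le_of_le_better hx he hm hem hQ hb hev hh hv

end Deliver

/-! ### Reachable configurations and feasibility -/

lemma fill_sublist (b t : ℕ) (l : List (Item I)) :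
    ∀ occ : Finset ℕ, (fill b t l occ).Sublist l := by
  induction l with
  | nil => exact fun _ => List.Sublist.refl _
  | cons x l ih =>
    intro occ
    rw [fill]
    split_ifs
    · exact (ih _).cons_cons x
    · exact (ih _).cons x

lemma ops_subperm (b t : ℕ) (S : List (Item I)) : (ops b t S).Subperm S := by
  obtain ⟨l, hl, -, hops⟩ := exists_sorted_perm b t S
  exact (hops.subperm.trans (fill_sublist b t l ∅).subperm).trans hl.subperm

/-- The invariant of the buffer during the arrivals of step `t`, where `sent` records what has been
sent in earlier steps. -/
structure Buffered (b t : ℕ) (sent : I.Schedule) (Q : List (Item I)) : Prop where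
  slotted : Slotted b t Q
  nodup : (Q.map Item.id).Nodup
  unsent : ∀ y ∈ Q, sent y.id = none
  release_le : ∀ y ∈ Q, I.r y.id ≤ t
  vd_le : ∀ y ∈ Q, y.vd ≤ I.d y.id

lemma exists_of_mem_reschedule {b t : ℕ} {S : List (Item I)} {y : Item I}
    (hy : y ∈ reschedule b t S) : ∃ x ∈ S, x.id = y.id ∧ y.vd ≤ x.vd := by
  obtain ⟨i, hi, rfl⟩ := List.mem_iff_getElem.1 hy
  have hi' : i < (ops b t S).length := length_reschedule b t S ▸ hi
  refine ⟨(ops b t S)[i], (ops_subperm b t S).subset (List.getElem_mem hi'), ?_⟩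
  rw [getElem_reschedule]
  exact ⟨rfl, le_vd_ops_getElem b t S hi'⟩

lemma nodup_map_id_reschedule {b t : ℕ} {S : List (Item I)} (h : (S.map Item.id).Nodup) :
    ((reschedule b t S).map Item.id).Nodup := by
  rw [map_id_reschedule]
  obtain ⟨l, hl, hsub⟩ := ops_subperm b t S
  exact (hl.map Item.id).nodup_iff.1 (h.sublist (hsub.map Item.id))

lemma Buffered.reschedule {b t : ℕ} {sent : I.Schedule} {Q : List (Item I)}
    (h : Buffered b t sent Q) : Buffered b t sent (reschedule b t Q) where
  slotted := slotted_reschedule b t Q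
  nodup := nodup_map_id_reschedule h.nodup
  unsent y hy := by
    obtain ⟨x, hx, hxy, -⟩ := exists_of_mem_reschedule hy
    exact hxy ▸ h.unsent x hx
  release_le y hy := by
    obtain ⟨x, hx, hxy, -⟩ := exists_of_mem_reschedule hy
    exact hxy ▸ h.release_le x hx
  vd_le y hy := by
    obtain ⟨x, hx, hxy, hle⟩ := exists_of_mem_reschedule hy
    exact hxy ▸ hle.trans (h.vd_le x hx)

lemma Buffered.reschedule_cons {b t : ℕ} {sent : I.Schedule} {Q : List (Item I)}
    (h : Buffered b t sent Q) {p : I.Id} (hp : p ∉ Q.map Item.id) (hs : sent p = none)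
    (hr : I.r p = t) : Buffered b t sent (FiniteQueue.reschedule b t (⟨p, I.d p⟩ :: Q)) where
  slotted := slotted_reschedule b t _
  nodup := nodup_map_id_reschedule (List.nodup_cons.2 ⟨hp, h.nodup⟩)
  unsent y hy := by
    obtain ⟨x, hx, hxy, -⟩ := exists_of_mem_reschedule hy
    rcases List.mem_cons.1 hx with rfl | hx
    exacts [hxy ▸ hs, hxy ▸ h.unsent x hx]
  release_le y hy := by
    obtain ⟨x, hx, hxy, -⟩ := exists_of_mem_reschedule hy
    rcases List.mem_cons.1 hx with rfl | hx
    exacts [hxy ▸ hr.le, hxy ▸ h.release_le x hx]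
  vd_le y hy := by
    obtain ⟨x, hx, hxy, hle⟩ := exists_of_mem_reschedule hy
    rcases List.mem_cons.1 hx with rfl | hx
    exacts [hxy ▸ hle, hxy ▸ hle.trans (h.vd_le x hx)]

/-- The buffer after the arrival of the packets in `l`. -/
def arriveList (b t : ℕ) (l : List I.Id) (Q : List (Item I)) : List (Item I) :=
  l.foldl (fun Q p => reschedule b t (⟨p, I.d p⟩ :: Q)) Q

lemma mem_map_id_arriveList {b t : ℕ} (l : List I.Id) :
    ∀ {Q : List (Item I)} {q : I.Id}, q ∈ (arriveList b t l Q).map Item.id →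
      q ∈ Q.map Item.id ∨ q ∈ l := by
  induction l with
  | nil => exact fun h => .inl h
  | cons p l ih =>
    intro Q q hq
    rcases ih hq with h | h
    · obtain ⟨y, hy, rfl⟩ := List.mem_map.1 h
      obtain ⟨x, hx, hxy, -⟩ := exists_of_mem_reschedule hy
      rcases List.mem_cons.1 hx with rfl | hx
      · exact .inr (by simp [← hxy])
      · exact .inl (hxy ▸ List.mem_map_of_mem hx)
    · exact .inr (List.mem_cons_of_mem _ h)

lemma Buffered.arriveList {b t : ℕ} {sent : I.Schedule} (l : List I.Id) (hl : l.Nodup)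
    (hs : ∀ p ∈ l, sent p = none) (hr : ∀ p ∈ l, I.r p = t) :
    ∀ {Q : List (Item I)}, Buffered b t sent Q → (∀ p ∈ l, p ∉ Q.map Item.id) →
      Buffered b t sent (arriveList b t l Q) := by
  induction l with
  | nil => exact fun h _ => h
  | cons p l ih =>
    intro Q h hd
    rw [List.nodup_cons] at hl
    refine ih hl.2 (fun q hq => hs q (by simp [hq])) (fun q hq => hr q (by simp [hq]))
      (h.reschedule_cons (hd p (by simp)) (hs p (by simp)) (hr p (by simp))) fun q hq hmem => ?_
    rcases mem_map_id_arriveList [p] hmem with h' | h'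
    · exact hd q (by simp [hq]) h'
    · obtain rfl : q = p := by simpa using h'
      exact hl.1 hq

lemma nodup_arrivals (t : ℕ) : (I.arrivals t).Nodup := (List.nodup_finRange _).filter _

lemma mem_arrivals {t : ℕ} {p : I.Id} : p ∈ I.arrivals t ↔ I.r p = t := by
  simp [Input.arrivals]

lemma arrive_eq (b t : ℕ) (Q : List (Item I)) :
    arrive b t Q = reschedule b t (arriveList b t (I.arrivals t) Q) := rfl

lemma exists_of_mem_arrive {b t : ℕ} {Q : List (Item I)} {y : Item I} (hy : y ∈ arrive b t Q) :
    y.id ∈ Q.map Item.id ∨ I.r y.id = t := by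
  rw [arrive_eq] at hy
  obtain ⟨x, hx, hxy, -⟩ := exists_of_mem_reschedule hy
  rw [← hxy, ← mem_arrivals]
  exact mem_map_id_arriveList _ (List.mem_map_of_mem hx)

/-- The invariant of the configurations that the algorithm can reach before step `n`. The last field
records the capacity constraint for the past: in every step `t < n` the packets released by then that
are sent from `t` on, or are still in the buffer, fit into a set `K` of size `b` (the buffer after the
arrivals of step `t`). -/
structure Reachable (b n : ℕ) (C : Config I) : Prop where
  slotted : Slotted b n C.queue
  nodup : (C.queue.map Item.id).Nodup
  unsent : ∀ y ∈ C.queue, C.sent y.id = none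
  release_lt : ∀ y ∈ C.queue, I.r y.id < n
  vd_le : ∀ y ∈ C.queue, y.vd ≤ I.d y.id
  sent_lt : ∀ p s, C.sent p = some s → s < n
  release_le : ∀ p s, C.sent p = some s → I.r p ≤ s
  le_deadline : ∀ p s, C.sent p = some s → s ≤ I.d p
  one_per_step : ∀ p q s, C.sent p = some s → C.sent q = some s → p = q
  capacity : ∀ t < n, ∃ K : Finset I.Id, K.card ≤ b ∧
    (∀ y ∈ C.queue, I.r y.id ≤ t → y.id ∈ K) ∧
    ∀ p s, C.sent p = some s → I.r p ≤ t → t ≤ s → p ∈ K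

lemma Reachable.buffered {b n : ℕ} {C : Config I} (h : Reachable b n C) :
    Buffered b n C.sent C.queue :=
  ⟨h.slotted, h.nodup, h.unsent, fun y hy => (h.release_lt y hy).le, h.vd_le⟩

lemma Reachable.buffered_arriveList {b n : ℕ} {C : Config I} (h : Reachable b n C) :
    Buffered b n C.sent (FiniteQueue.arriveList b n (I.arrivals n) C.queue) := by
  refine h.buffered.arriveList _ (nodup_arrivals n) (fun p hp => ?_)
    (fun p hp => mem_arrivals.1 hp) fun p hp hmem => ?_
  · rw [mem_arrivals] at hp
    cases hs : C.sent p with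
    | none => rfl
    | some s =>
      have := h.sent_lt p s hs
      have := h.release_le p s hs
      omega
  · rw [mem_arrivals] at hp
    obtain ⟨y, hy, rfl⟩ := List.mem_map.1 hmem
    have := h.release_lt y hy
    omega

lemma Reachable.buffered_arrive {b n : ℕ} {C : Config I} (h : Reachable b n C) :
    Buffered b n C.sent (arrive b n C.queue) :=
  arrive_eq b n C.queue ▸ h.buffered_arriveList.reschedule

lemma choose_nil (α : ℝ) (γ : unitInterval) : choose α γ ([] : List (Item I)) = PMF.pure none :=
  rfl

open Classical in
lemma exists_choose_cons (α : ℝ) (γ : unitInterval) (e : Item I) (Q : List (Item I)) :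
    ∃ h ∈ e :: Q, (∀ y ∈ e :: Q, I.w y.id ≤ I.w h.id) ∧
      choose α γ (e :: Q) = if (I.w e.id : ℝ) ≥ (I.w h.id : ℝ) / α then PMF.pure (some e)
        else (coin γ).map fun c => if c then some e else some h := by
  cases harg : (e :: Q).argmax fun x => I.w x.id with
  | none => simp [List.argmax_eq_none] at harg
  | some h =>
    refine ⟨h, List.argmax_mem harg, fun y hy => List.le_of_mem_argmax (f := fun x : Item I => I.w x.id) hy harg, ?_⟩
    unfold choose
    rw [harg]
    rfl

lemma mem_of_mem_support_choose {α : ℝ} {γ : unitInterval} {Q : List (Item I)} {x : Item I}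
    (hx : some x ∈ (choose α γ Q).support) : x ∈ Q := by
  cases Q with
  | nil => simp [choose_nil] at hx
  | cons e Q =>
    obtain ⟨h, hh, -, hc⟩ := exists_choose_cons α γ e Q
    rw [hc] at hx
    split_ifs at hx
    · simp only [PMF.support_pure, Set.mem_singleton_iff, Option.some.injEq] at hx
      simp [hx]
    · rw [PMF.mem_support_map_iff] at hx
      obtain ⟨c, -, hc⟩ := hx
      cases c
      · obtain rfl : h = x := by simpa using hc
        exact hh
      · obtain rfl : e = x := by simpa using hc
        simp

lemma reachable_init (b : ℕ) : Reachable (I := I) b 0 ⟨[], fun _ => none⟩ := by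
  refine ⟨⟨?_, ?_, ?_⟩, ?_, ?_, ?_, ?_, ?_, ?_, ?_, ?_, ?_⟩ <;> simp

lemma Reachable.deliver_none {b n : ℕ} {C : Config I} (h : Reachable b n C) :
    Reachable b (n + 1) (deliver n (arrive b n C.queue) C.sent none) := by
  have hQ := h.buffered_arrive
  have hmem : ∀ y ∈ (arrive b n C.queue).filter fun y => n < y.vd,
      y ∈ arrive b n C.queue ∧ n < y.vd := by simp
  refine ⟨⟨?_, ?_, ?_⟩, ?_, ?_, ?_, ?_, ?_, h.release_le, h.le_deadline, h.one_per_step, ?_⟩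
  · exact hQ.slotted.nodup.sublist (List.filter_sublist.map _)
  · exact fun y hy => (hmem y hy).2
  · exact fun y hy => (hQ.slotted.vd_lt y (hmem y hy).1).trans (by omega)
  · exact hQ.nodup.sublist (List.filter_sublist.map _)
  · exact fun y hy => hQ.unsent y (hmem y hy).1
  · exact fun y hy => Nat.lt_succ_of_le (hQ.release_le y (hmem y hy).1)
  · exact fun y hy => hQ.vd_le y (hmem y hy).1
  · exact fun p s hs => (h.sent_lt p s hs).trans (Nat.lt_succ_self n)
  · intro t ht
    rcases Nat.lt_succ_iff_lt_or_eq.1 ht with ht | rfl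
    · obtain ⟨K, hK, h1, h2⟩ := h.capacity t ht
      refine ⟨K, hK, fun y hy hr => ?_, h2⟩
      rcases exists_of_mem_arrive (hmem y hy).1 with hold | hnew
      · obtain ⟨x, hx, hxy⟩ := List.mem_map.1 hold
        rw [← hxy] at hr ⊢
        exact h1 x hx hr
      · omega
    · refine ⟨((arrive b t C.queue).map Item.id).toFinset, ?_, fun y hy _ => ?_,
        fun p s hs _ hts => ?_⟩
      · refine (List.toFinset_card_le _).trans ?_
        rw [List.length_map, arrive_eq, length_reschedule]
        exact length_ops_le _ _ _
      · exact List.mem_toFinset.2 (List.mem_map_of_mem (hmem y hy).1)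
      · have := h.sent_lt p s hs
        omega

lemma Reachable.deliver_some {b n : ℕ} {C : Config I} (h : Reachable b n C) {x : Item I}
    (hx : x ∈ arrive b n C.queue) :
    Reachable b (n + 1) (deliver n (arrive b n C.queue) C.sent (some x)) := by
  have hQ := h.buffered_arrive
  have hsub : (((arrive b n C.queue).erase x).filter fun y => n < y.vd).Sublist
    (arrive b n C.queue) := List.filter_sublist.trans List.erase_sublist
  have hmem : ∀ y ∈ ((arrive b n C.queue).erase x).filter fun y => n < y.vd,
      y ∈ arrive b n C.queue ∧ n < y.vd := fun y hy =>
    ⟨hsub.subset hy, by simpa using (List.mem_filter.1 hy).2⟩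
  have hne : ∀ y ∈ ((arrive b n C.queue).erase x).filter fun y => n < y.vd, y.id ≠ x.id := by
    intro y hy hyx
    obtain rfl : y = x := List.inj_on_of_nodup_map hQ.nodup (hmem y hy).1 hx hyx
    exact List.Nodup.not_mem_erase hQ.nodup.of_map (List.mem_filter.1 hy).1
  have hsent : ∀ p s, Function.update C.sent x.id (some n) p = some s →
      (p = x.id ∧ s = n) ∨ (p ≠ x.id ∧ C.sent p = some s) := fun p s hs => by
    by_cases hp : p = x.id
    · subst hp
      rw [Function.update_self, Option.some.injEq] at hs
      exact .inl ⟨rfl, hs.symm⟩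
    · rw [Function.update_of_ne hp] at hs
      exact .inr ⟨hp, hs⟩
  refine ⟨⟨?_, ?_, ?_⟩, ?_, ?_, ?_, ?_, ?_, ?_, ?_, ?_, ?_⟩
  · exact hQ.slotted.nodup.sublist (hsub.map _)
  · exact fun y hy => (hmem y hy).2
  · exact fun y hy => (hQ.slotted.vd_lt y (hmem y hy).1).trans (by omega)
  · exact hQ.nodup.sublist (hsub.map _)
  · exact fun y hy => (Function.update_of_ne (hne y hy) _ _).trans (hQ.unsent y (hmem y hy).1)
  · exact fun y hy => Nat.lt_succ_of_le (hQ.release_le y (hmem y hy).1)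
  · exact fun y hy => hQ.vd_le y (hmem y hy).1
  · intro p s hs
    rcases hsent p s hs with ⟨-, rfl⟩ | ⟨-, hs⟩
    · exact Nat.lt_succ_self _
    · exact (h.sent_lt p s hs).trans (Nat.lt_succ_self n)
  · intro p s hs
    rcases hsent p s hs with ⟨rfl, rfl⟩ | ⟨-, hs⟩
    · exact hQ.release_le x hx
    · exact h.release_le p s hs
  · intro p s hs
    rcases hsent p s hs with ⟨rfl, rfl⟩ | ⟨-, hs⟩
    · exact (hQ.slotted.le_vd x hx).trans (hQ.vd_le x hx)
    · exact h.le_deadline p s hs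
  · intro p q s hp hq
    rcases hsent p s hp with ⟨rfl, rfl⟩ | ⟨-, hp⟩ <;>
      rcases hsent q _ hq with ⟨rfl, hs⟩ | ⟨-, hq⟩
    · rfl
    · exact absurd (h.sent_lt q _ hq) (lt_irrefl _)
    · exact absurd (hs ▸ h.sent_lt p _ hp) (lt_irrefl _)
    · exact h.one_per_step p q s hp hq
  · intro t ht
    rcases Nat.lt_succ_iff_lt_or_eq.1 ht with ht | rfl
    · obtain ⟨K, hK, h1, h2⟩ := h.capacity t ht
      have hold : ∀ y ∈ arrive b n C.queue, I.r y.id ≤ t → y.id ∈ K := fun y hy hr => by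
        rcases exists_of_mem_arrive hy with hold | hnew
        · obtain ⟨z, hz, hzy⟩ := List.mem_map.1 hold
          rw [← hzy] at hr ⊢
          exact h1 z hz hr
        · omega
      refine ⟨K, hK, fun y hy hr => hold y (hmem y hy).1 hr, fun p s hs hr hts => ?_⟩
      rcases hsent p s hs with ⟨rfl, rfl⟩ | ⟨-, hs⟩
      · exact hold x hx hr
      · exact h2 p s hs hr hts
    · refine ⟨((arrive b t C.queue).map Item.id).toFinset, ?_, fun y hy _ => ?_,
        fun p s hs _ hts => ?_⟩
      · refine (List.toFinset_card_le _).trans ?_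
        rw [List.length_map, arrive_eq, length_reschedule]
        exact length_ops_le _ _ _
      · exact List.mem_toFinset.2 (List.mem_map_of_mem (hmem y hy).1)
      · rcases hsent p s hs with ⟨rfl, rfl⟩ | ⟨-, hs⟩
        · exact List.mem_toFinset.2 (List.mem_map_of_mem hx)
        · have := h.sent_lt p s hs
          omega

lemma reachable_of_mem_support_run {b : ℕ} {α : ℝ} {γ : unitInterval} (n : ℕ) :
    ∀ {C : Config I}, C ∈ (run I b α γ n).support → Reachable b n C := by
  induction n with
  | zero =>
    intro C hC
    rw [run, PMF.support_pure, Set.mem_singleton_iff] at hC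
    exact hC ▸ reachable_init b
  | succ n ih =>
    intro C hC
    rw [run, PMF.mem_support_bind_iff] at hC
    obtain ⟨C₀, hC₀, hC⟩ := hC
    rw [step, PMF.mem_support_map_iff] at hC
    obtain ⟨o, ho, rfl⟩ := hC
    cases o with
    | none => exact (ih hC₀).deliver_none
    | some x => exact (ih hC₀).deliver_some (mem_of_mem_support_choose ho)

/-- At the horizon, the packets sent so far form a feasible schedule. -/
lemma Reachable.feasible {b : ℕ} {C : Config I} (h : Reachable b I.horizon C) :
    I.Feasible b C.sent where
  release_le := h.release_le
  le_deadline := h.le_deadline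
  one_per_step := h.one_per_step
  capacity t := by
    by_cases ht : t < I.horizon
    · obtain ⟨K, hK, -, h2⟩ := h.capacity t ht
      refine (Set.ncard_le_ncard (t := (K : Set I.Id)) ?_).trans (by rwa [Set.ncard_coe_finset])
      rintro p ⟨hr, s, hs, hts⟩
      exact h2 p s hs hr hts
    · convert Nat.zero_le b
      rw [Set.ncard_eq_zero, Set.eq_empty_iff_forall_notMem]
      rintro p ⟨hr, s, hs, hts⟩
      have := h.sent_lt p s hs
      omega

/-! ### The potential and the arrivals of a step -/

/-- The slots from `t` on in which the schedule `S` sends a packet of the set `A`. -/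
def booked (S : I.Schedule) (t : ℕ) (A : Finset I.Id) : Finset ℕ :=
  (A.biUnion fun p => (S p).toFinset).filter (t ≤ ·)

lemma mem_booked {S : I.Schedule} {t s : ℕ} {A : Finset I.Id} :
    s ∈ booked S t A ↔ t ≤ s ∧ ∃ p ∈ A, S p = some s := by
  simp [booked, and_comm]

lemma booked_succ (S : I.Schedule) (t : ℕ) (A : Finset I.Id) :
    booked S (t + 1) A = (booked S t A).erase t := by
  ext s
  rw [Finset.mem_erase, mem_booked, mem_booked, ← and_assoc]
  refine and_congr_left fun _ => ?_
  omega

lemma booked_insert {b : ℕ} {S : I.Schedule} (hS : I.Feasible b S) {p : I.Id} (A : Finset I.Id) :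
    booked S (I.r p) (insert p A) = insertSlot (S p) (booked S (I.r p) A) := by
  ext s
  cases hp : S p with
  | none => simp [insertSlot, mem_booked, hp]
  | some u =>
    have hu := hS.release_le p u hp
    simp only [insertSlot, Option.elim_some, Finset.mem_insert, mem_booked, exists_eq_or_imp, hp,
      Option.some.injEq]
    constructor
    · rintro ⟨h1, rfl | h2⟩
      exacts [.inl rfl, .inr ⟨h1, h2⟩]
    · rintro (rfl | ⟨h1, h2⟩)
      exacts [⟨hu, .inl rfl⟩, ⟨h1, .inr h2⟩]

lemma card_booked_le {b : ℕ} {S : I.Schedule} (hS : I.Feasible b S) {t : ℕ} {A : Finset I.Id}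
    (hA : ∀ p ∈ A, I.r p ≤ t) : (booked S t A).card ≤ b := by
  refine le_trans ?_ (hS.capacity t)
  rw [← Set.ncard_coe_finset]
  refine (Set.ncard_le_ncard (t := (fun p => (S p).getD 0) ''
    {p : I.Id | I.r p ≤ t ∧ ∃ s, S p = some s ∧ t ≤ s}) ?_ ?_).trans (Set.ncard_image_le ?_)
  · intro s hs
    obtain ⟨hts, p, hp, hps⟩ := mem_booked.1 (Finset.mem_coe.1 hs)
    exact ⟨p, ⟨hA p hp, s, hps, hts⟩, by simp [hps]⟩
  · exact Set.toFinite _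
  · exact Set.toFinite _

/-- The potential of a buffer for prices `m`: the contributions of all levels in `V`, scaled by the
gaps `g` between the levels. -/
def pot (V : Finset ℝ≥0) (g : ℝ≥0 → ℝ≥0) (t N : ℕ) (m : ℕ → ℝ≥0) (B : Finset ℕ)
    (Q : List (Item I)) : ℝ :=
  ∑ x ∈ V, (g x : ℝ) * levelPot x t N m B Q

/-- Positive levels and gaps such that the gaps up to the value of a packet add up to this value. -/
structure IsLevels (I : Input) (V : Finset ℝ≥0) (g : ℝ≥0 → ℝ≥0) : Prop where
  pos : ∀ x ∈ V, 0 < x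
  sum_gap : ∀ p, ∑ x ∈ V with x ≤ I.w p, g x = I.w p

lemma exists_isLevels (I : Input) : ∃ V g, IsLevels I V g := by
  classical
  obtain ⟨g, hg⟩ := exists_gap ((Finset.univ.image I.w).filter (0 < ·))
  refine ⟨(Finset.univ.image I.w).filter (0 < ·), g, fun x hx => (Finset.mem_filter.1 hx).2,
    fun p => ?_⟩
  rw [hg]
  refine le_antisymm (Finset.sup_le fun x hx => (Finset.mem_filter.1 hx).2) ?_
  rcases eq_zero_or_pos (I.w p) with h | h
  · rw [h]
    exact zero_le
  · exact Finset.le_sup (f := id) (Finset.mem_filter.2 ⟨Finset.mem_filter.2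
      ⟨Finset.mem_image_of_mem _ (Finset.mem_univ p), h⟩, le_rfl⟩)

section Potential

variable {V : Finset ℝ≥0} {g : ℝ≥0 → ℝ≥0}

lemma IsLevels.sum_mul_ite (hV : IsLevels I V g) (p : I.Id) :
    ∑ x ∈ V, (g x : ℝ) * (if x ≤ I.w p then 1 else 0) = I.w p := by
  have h := congrArg ((↑) : ℝ≥0 → ℝ) (hV.sum_gap p)
  rw [NNReal.coe_sum, Finset.sum_filter] at h
  rw [← h]
  exact Finset.sum_congr rfl fun x _ => by simp

lemma pot_mono {t t' N : ℕ} {m m' : ℕ → ℝ≥0} {B B' : Finset ℕ} {Q Q' : List (Item I)}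
    (h : ∀ x ∈ V, levelPot x t N m B Q ≤ levelPot x t' N m' B' Q') :
    pot V g t N m B Q ≤ pot V g t' N m' B' Q' :=
  Finset.sum_le_sum fun x hx => mul_le_mul_of_nonneg_left (by exact_mod_cast h x hx) (g x).2

lemma IsLevels.pot_le_add (hV : IsLevels I V g) {t t' N : ℕ} {m m' : ℕ → ℝ≥0} {B B' : Finset ℕ}
    {Q Q' : List (Item I)} {p q : I.Id} {a c : ℕ}
    (h : ∀ x ∈ V, levelPot x t N m B Q ≤ levelPot x t' N m' B' Q' +
      (a * (if x ≤ I.w p then 1 else 0) + c * if x ≤ I.w q then 1 else 0)) :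
    pot V g t N m B Q ≤ pot V g t' N m' B' Q' + (a * I.w p + c * I.w q) := by
  rw [← hV.sum_mul_ite p, ← hV.sum_mul_ite q, Finset.mul_sum, Finset.mul_sum,
    ← Finset.sum_add_distrib, pot, pot, ← Finset.sum_add_distrib]
  refine Finset.sum_le_sum fun x hx => ?_
  have h1 : (levelPot x t N m B Q : ℝ) ≤ levelPot x t' N m' B' Q' +
      (a * (if x ≤ I.w p then 1 else 0) + c * if x ≤ I.w q then 1 else 0) := by
    exact_mod_cast h x hx
  have h2 := mul_le_mul_of_nonneg_left h1 (g x).2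
  calc (g x : ℝ) * levelPot x t N m B Q ≤ _ := h2
    _ = _ := by simp only [NNReal.val_eq_coe]; ring

lemma IsLevels.pot_add_le (hV : IsLevels I V g) {t t' N : ℕ} {m m' : ℕ → ℝ≥0} {B B' : Finset ℕ}
    {Q Q' : List (Item I)} {p : I.Id} {o : Option ℕ}
    (h : ∀ x ∈ V, levelPot x t N m B Q + (if o.isSome ∧ x ≤ I.w p then 1 else 0) ≤
      levelPot x t' N m' B' Q') :
    pot V g t N m B Q + (if o.isSome then I.w p else 0 : ℝ≥0) ≤ pot V g t' N m' B' Q' := by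
  cases o with
  | none =>
    simp only [Option.isSome_none, Bool.false_eq_true, false_and, if_false, add_zero,
      NNReal.coe_zero] at h ⊢
    exact pot_mono h
  | some s =>
    simp only [Option.isSome_some, true_and, if_true] at h ⊢
    rw [← hV.sum_mul_ite p, pot, pot, ← Finset.sum_add_distrib]
    refine Finset.sum_le_sum fun x hx => ?_
    rw [← mul_add]
    exact mul_le_mul_of_nonneg_left (by exact_mod_cast h x hx) (g x).2

/-- Arrivals increase the potential by the value of the arriving packets that the reference schedule
sends. -/
lemma IsLevels.exists_price_arriveList (hV : IsLevels I V g) {b N : ℕ} (hb : 0 < b)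
    {S : I.Schedule} (hS : I.Feasible b S) (hN : ∀ p s, S p = some s → s < N) {t : ℕ}
    (l : List I.Id) (hl : l.Nodup) (hr : ∀ p ∈ l, I.r p = t) :
    ∀ (A : Finset I.Id), (∀ p ∈ A, I.r p ≤ t) → (∀ p ∈ l, p ∉ A) →
      ∀ {Q : List (Item I)}, Slotted b t Q → ∀ {m : ℕ → ℝ≥0}, Antitone m →
      (∀ x ∈ V, idle x t N m (booked S t A) ≤ paid x m Item.vd Q) →
      ∃ m' : ℕ → ℝ≥0, Antitone m' ∧
        pot V g t N m (booked S t A) Q +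
          (l.map fun p => if (S p).isSome then I.w p else 0).sum ≤
        pot V g t N m' (booked S t (A ∪ l.toFinset)) (arriveList b t l Q) ∧
        Slotted b t (arriveList b t l Q) := by
  induction l with
  | nil => exact fun A _ _ Q hQ m hm _ => ⟨m, hm, by simp [arriveList], hQ⟩
  | cons p l ih =>
    intro A hA hlA Q hQ m hm hnorm
    rw [List.nodup_cons] at hl
    have hrp : I.r p = t := hr p (by simp)
    have hins : booked S t (insert p A) = insertSlot (S p) (booked S t A) := by
      rw [← hrp]
      exact booked_insert hS A
    have hA' : ∀ q ∈ insert p A, I.r q ≤ t := fun q hq => by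
      rcases Finset.mem_insert.1 hq with rfl | hq
      exacts [hrp.le, hA q hq]
    obtain ⟨m₁, hm₁, h1⟩ := exists_price_arrival (N := N) (o := S p) (B := booked S t A) hb hQ
      ⟨p, I.d p⟩ (fun s hs => ⟨hrp ▸ hS.release_le p s hs, hN p s hs, fun hmem => by
        obtain ⟨-, q, hq, hqs⟩ := mem_booked.1 hmem
        exact hlA p (by simp) (hS.one_per_step p q s hs hqs ▸ hq)⟩)
      (fun s hs => hS.le_deadline p s hs) (hins ▸ card_booked_le hS hA') hm
    rw [← hins] at h1
    obtain ⟨m₂, hm₂, h2, h3⟩ := ih hl.2 (fun q hq => hr q (by simp [hq])) (insert p A) hA'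
      (fun q hq hmem => by
        rcases Finset.mem_insert.1 hmem with rfl | hmem
        exacts [hl.1 hq, hlA q (by simp [hq]) hmem])
      (slotted_reschedule b t (⟨p, I.d p⟩ :: Q)) hm₁
      fun x hx => (h1 x (hV.pos x hx) (hnorm x hx)).1
    have h4 := hV.pot_add_le fun x hx => (h1 x (hV.pos x hx) (hnorm x hx)).2
    refine ⟨m₂, hm₂, ?_, h3⟩
    have h5 : A ∪ (p :: l).toFinset = insert p A ∪ l.toFinset := by
      ext q
      simp only [List.toFinset_cons, Finset.mem_union, Finset.mem_insert]
      tauto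
    rw [h5, List.map_cons, List.sum_cons, NNReal.coe_add]
    refine le_trans ?_ h2
    rw [← add_assoc]
    gcongr

/-- The packets released before step `n`. -/
def released (I : Input) (n : ℕ) : Finset I.Id := Finset.univ.filter fun p => I.r p < n

lemma released_succ (n : ℕ) : released I (n + 1) = released I n ∪ (I.arrivals n).toFinset := by
  ext p
  simp only [released, Finset.mem_union, Finset.mem_filter, Finset.mem_univ, true_and,
    List.mem_toFinset, mem_arrivals]
  omega

/-- The value of the packets released before step `n` that the schedule `S` ever sends. -/
def committed (S : I.Schedule) (n : ℕ) : ℝ≥0 :=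
  ∑ p ∈ released I n, if (S p).isSome then I.w p else 0

lemma committed_succ (S : I.Schedule) (n : ℕ) : committed S (n + 1) = committed S n +
    ((I.arrivals n).map fun p => if (S p).isSome then I.w p else 0).sum := by
  unfold committed
  rw [released_succ, Finset.sum_union, List.sum_toFinset _ (nodup_arrivals n)]
  rw [Finset.disjoint_left]
  intro p hp hp'
  rw [List.mem_toFinset, mem_arrivals] at hp'
  have := (Finset.mem_filter.1 hp).2
  omega

/-- The optimal potential of a configuration before step `n`. -/
def optPot (V : Finset ℝ≥0) (g : ℝ≥0 → ℝ≥0) (N : ℕ) (S : I.Schedule) (n : ℕ)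
    (Q : List (Item I)) : ℝ≥0∞ :=
  ⨆ (m : ℕ → ℝ≥0) (_ : Antitone m), ENNReal.ofReal (pot V g n N m (booked S n (released I n)) Q)

lemma le_optPot {N : ℕ} {S : I.Schedule} {n : ℕ} {Q : List (Item I)} {m : ℕ → ℝ≥0}
    (hm : Antitone m) :
    ENNReal.ofReal (pot V g n N m (booked S n (released I n)) Q) ≤ optPot V g N S n Q :=
  le_iSup₂ (f := fun (m : ℕ → ℝ≥0) (_ : Antitone m) =>
    ENNReal.ofReal (pot V g n N m (booked S n (released I n)) Q)) m hm

/-- Before the delivery of step `n`, suitable prices for the buffer pay for the optimal potential at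
the start of the step and for the packets that have arrived since then. -/
lemma IsLevels.exists_price_arrive (hV : IsLevels I V g) {b N : ℕ} (hb : 0 < b)
    {S : I.Schedule} (hS : I.Feasible b S) (hN : ∀ p s, S p = some s → s < N) {n : ℕ}
    {Q : List (Item I)} (hQ : Slotted b n Q) {m : ℕ → ℝ≥0} (hm : Antitone m) :
    ∃ m' : ℕ → ℝ≥0, Antitone m' ∧
      ENNReal.ofReal (pot V g n N m (booked S n (released I n)) Q) +
        (((I.arrivals n).map fun p => if (S p).isSome then I.w p else 0).sum : ℝ≥0) ≤
      ENNReal.ofReal (pot V g n N m' (booked S n (released I (n + 1))) (arrive b n Q)) := by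
  obtain ⟨m₁, hm₁, h1⟩ := exists_normal_price V n N (booked S n (released I n)) Q hm
  have hrel : ∀ p ∈ released I n, I.r p < n := fun p hp => (Finset.mem_filter.1 hp).2
  obtain ⟨m₂, hm₂, h2, h3⟩ := hV.exists_price_arriveList hb hS hN (I.arrivals n)
    (nodup_arrivals n) (fun p hp => mem_arrivals.1 hp) (released I n) (fun p hp => (hrel p hp).le)
    (fun p hp hp' => (hrel p hp').ne (mem_arrivals.1 hp)) hQ hm₁
    fun x hx => (h1 x hx (hV.pos x hx)).1
  obtain ⟨m₃, hm₃, h4⟩ := exists_price_reschedule_slotted (N := N)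
    (B := booked S n (released I (n + 1))) hb h3 hm₂
  refine ⟨m₃, hm₃, ?_⟩
  rw [← released_succ] at h2
  have h5 : pot V g n N m (booked S n (released I n)) Q ≤
      pot V g n N m₁ (booked S n (released I n)) Q :=
    pot_mono fun x hx => (h1 x hx (hV.pos x hx)).2
  have h6 := pot_mono (V := V) (g := g) fun x hx => h4 x (hV.pos x hx)
  -- after normalization the potential is nonnegative
  have h7 : 0 ≤ pot V g n N m₁ (booked S n (released I n)) Q := by
    refine Finset.sum_nonneg fun x hx => mul_nonneg (g x).2 ?_
    have := (h1 x hx (hV.pos x hx)).1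
    have : 0 ≤ levelPot x n N m₁ (booked S n (released I n)) Q := by
      unfold levelPot
      omega
    exact_mod_cast this
  calc _ ≤ ENNReal.ofReal (pot V g n N m₁ (booked S n (released I n)) Q) +
        (((I.arrivals n).map fun p => if (S p).isSome then I.w p else 0).sum : ℝ≥0) := by gcongr
    _ = ENNReal.ofReal (pot V g n N m₁ (booked S n (released I n)) Q +
        (((I.arrivals n).map fun p => if (S p).isSome then I.w p else 0).sum : ℝ≥0)) := by
      rw [ENNReal.ofReal_add h7 (NNReal.coe_nonneg _), ENNReal.ofReal_coe_nnreal]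
    _ ≤ _ := ENNReal.ofReal_le_ofReal (h2.trans h6)

end Potential

/-! ### One step in expectation, and the competitive ratio -/

lemma throughput_update {sent : I.Schedule} {p : I.Id} (hp : sent p = none) (t : ℕ) :
    I.throughput (Function.update sent p (some t)) = I.throughput sent + I.w p := by
  unfold Input.throughput
  rw [← Finset.add_sum_erase _ _ (Finset.mem_univ p),
    ← Finset.add_sum_erase Finset.univ (fun q => if (sent q).isSome then I.w q else 0)
      (Finset.mem_univ p), Function.update_self, hp]
  have : ∀ q ∈ Finset.univ.erase p,
      (if (Function.update sent p (some t) q).isSome then I.w q else 0) =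
        if (sent q).isSome then I.w q else 0 := fun q hq => by
    rw [Function.update_of_ne (Finset.ne_of_mem_erase hq)]
  rw [Finset.sum_congr rfl this]
  simp [add_comm]

/-- The balance of a step that sends `e` with probability `γ` and `h` with probability `1 - γ`. -/
lemma ofReal_le_of_coin {γ K P P₁ P₂ c₁ c₂ : ℝ} {u v : ℝ≥0} (h0 : 0 ≤ γ) (h1 : γ ≤ 1) (hK : 0 ≤ K)
    (hP₁ : P ≤ P₁ + c₁) (hP₂ : P ≤ P₂ + c₂)
    (hc : γ * c₁ + (1 - γ) * c₂ ≤ K * (γ * u + (1 - γ) * v)) :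
    ENNReal.ofReal P ≤
      ENNReal.ofReal γ * (ENNReal.ofReal K * u + ENNReal.ofReal P₁) +
        ENNReal.ofReal (1 - γ) * (ENNReal.ofReal K * v + ENNReal.ofReal P₂) := by
  have h1' : 0 ≤ 1 - γ := sub_nonneg.2 h1
  have hmul : ∀ (r : ℝ≥0) (q : ℝ), ENNReal.ofReal K * r + ENNReal.ofReal q =
      ENNReal.ofReal (K * r + max q 0) := fun r q => by
    rw [ENNReal.ofReal_add (mul_nonneg hK r.coe_nonneg) (le_max_right q 0), ENNReal.ofReal_mul hK,
      ENNReal.ofReal_coe_nnreal]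
    congr 1
    rcases le_total q 0 with hq | hq
    · rw [max_eq_right hq, ENNReal.ofReal_of_nonpos hq, ENNReal.ofReal_zero]
    · rw [max_eq_left hq]
  have hnn : ∀ (r : ℝ≥0) (q : ℝ), 0 ≤ K * r + max q 0 := fun r q =>
    add_nonneg (mul_nonneg hK r.coe_nonneg) (le_max_right _ _)
  rw [hmul, hmul, ← ENNReal.ofReal_mul h0, ← ENNReal.ofReal_mul h1',
    ← ENNReal.ofReal_add (mul_nonneg h0 (hnn _ _)) (mul_nonneg h1' (hnn _ _))]
  refine ENNReal.ofReal_le_ofReal ?_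
  have h2 := mul_le_mul_of_nonneg_left (hP₁.trans (add_le_add_left (le_max_left P₁ 0) c₁)) h0
  have h3 := mul_le_mul_of_nonneg_left (hP₂.trans (add_le_add_left (le_max_left P₂ 0) c₂)) h1'
  linarith

/-- The losses of potential are covered in expectation by the packet that is sent. -/
lemma coin_budget {u v : ℝ} (hu : 0 ≤ u) (huv : Real.goldenRatio * u ≤ v) {a₁ c₁ a₂ c₂ : ℕ}
    (h : (a₁, c₁, a₂, c₂) = (0, 1, 1, 2) ∨ (a₁, c₁, a₂, c₂) = (2, 0, 3, 1) ∨
      (a₁, c₁, a₂, c₂) = (0, 1, 0, 1)) :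
    (invGoldenSq : ℝ) * (a₁ * u + c₁ * v) + (1 - invGoldenSq) * (a₂ * u + c₂ * v) ≤
      Real.goldenRatio ^ 2 * (invGoldenSq * u + (1 - invGoldenSq) * v) := by
  have hφ := Real.goldenRatio_sq
  have hφ1 := Real.one_lt_goldenRatio
  have hv : 0 ≤ v := le_trans (by positivity) huv
  -- with `φ² = φ + 1` one has `1 / φ² = 2 - φ`
  have hγ : (invGoldenSq : ℝ) = 2 - Real.goldenRatio := by
    change 1 / Real.goldenRatio ^ 2 = _
    rw [div_eq_iff (by positivity)]
    nlinarith
  rw [hγ]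
  set φ := Real.goldenRatio
  have hR : φ ^ 2 * ((2 - φ) * u + (1 - (2 - φ)) * v) = u + φ * v := by
    have h3 : φ ^ 3 = 2 * φ + 1 := by nlinarith
    linear_combination (2 * u - v) * hφ + (v - u) * h3
  rw [hR]
  have hφ2 : φ < 2 := Real.goldenRatio_lt_two
  simp only [Prod.mk.injEq] at h
  rcases h with ⟨rfl, rfl, rfl, rfl⟩ | ⟨rfl, rfl, rfl, rfl⟩ | ⟨rfl, rfl, rfl, rfl⟩ <;>
    push_cast <;> nlinarith

section Step

variable {V : Finset ℝ≥0} {g : ℝ≥0 → ℝ≥0}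

lemma sorted_vd_arrive (b t : ℕ) (Q : List (Item I)) {e : Item I} {R : List (Item I)}
    (h : arrive b t Q = e :: R) : e.vd = t ∧ ∀ y ∈ R, t < y.vd := by
  have h1 := map_vd_reschedule b t (arriveList b t (I.arrivals t) Q)
  rw [← arrive_eq, h] at h1
  cases hlen : (ops b t (arriveList b t (I.arrivals t) Q)).length with
  | zero => simp [hlen] at h1
  | succ k =>
    rw [hlen, List.range'_succ, List.map_cons, List.cons.injEq] at h1
    refine ⟨h1.1, fun y hy => ?_⟩
    have := List.mem_map_of_mem (f := Item.vd) hy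
    rw [h1.2, List.mem_range'_1] at this
    omega

/-- The expected gain of a step in throughput, scaled by the competitive ratio, pays for the loss of
potential since the arrivals of that step. -/
lemma IsLevels.pot_le_expect_deliver (hV : IsLevels I V g) {b N : ℕ} {S : I.Schedule} {n : ℕ}
    (hn : n < N) {C : Config I} (hC : Reachable b n C) {m : ℕ → ℝ≥0} (hm : Antitone m) :
    ENNReal.ofReal (pot V g n N m (booked S n (released I (n + 1))) (arrive b n C.queue)) +
        ENNReal.ofReal (Real.goldenRatio ^ 2) * I.throughput C.sent ≤
      expect (step b Real.goldenRatio invGoldenSq n C) fun C' =>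
        ENNReal.ofReal (Real.goldenRatio ^ 2) * I.throughput C'.sent +
          optPot V g N S (n + 1) C'.queue := by
  rw [step, expect_map]
  have hQ := hC.buffered_arrive
  have hopt : ∀ (m' : ℕ → ℝ≥0) (Q : List (Item I)), Antitone m' → ENNReal.ofReal
      (pot V g (n + 1) N m' ((booked S n (released I (n + 1))).erase n) Q) ≤
      optPot V g N S (n + 1) Q := fun m' Q hm' => by
    rw [← booked_succ]
    exact le_optPot hm'
  set B := booked S n (released I (n + 1))
  cases hQe : arrive b n C.queue with
  | nil =>
    rw [choose_nil, expect_pure, add_comm]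
    refine add_le_add_right (le_trans ?_ (hopt m _ hm)) _
    exact ENNReal.ofReal_le_ofReal (pot_mono fun x _ => levelPot_nil_le hn m B)
  | cons e R =>
    rw [hQe] at hQ
    obtain ⟨he, hR⟩ := sorted_vd_arrive b n C.queue hQe
    have hfilter : ∀ R' : List (Item I), R' ⊆ R → (R'.filter fun y => n < y.vd) = R' :=
      fun R' h => List.filter_eq_self.2 fun y hy => by simpa using hR y (h hy)
    have hthr : ∀ y ∈ e :: R, I.throughput (Function.update C.sent y.id (some n)) =
        I.throughput C.sent + I.w y.id := fun y hy => throughput_update (hQ.unsent y hy) n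
    have hfirst : deliver n (e :: R) C.sent (some e) =
        ⟨R, Function.update C.sent e.id (some n)⟩ := by
      rw [deliver, List.erase_cons_head, hfilter R (List.Subset.refl R)]
    obtain ⟨h, hh, hmax, hchoose⟩ := exists_choose_cons Real.goldenRatio invGoldenSq e R
    have heh := hmax e (by simp)
    have hmaxR : ∀ y ∈ R, I.w y.id ≤ I.w h.id := fun y hy => hmax y (by simp [hy])
    rw [hchoose]
    split_ifs with hdet
    · rw [ge_iff_le, div_le_iff₀ Real.goldenRatio_pos] at hdet
      have hpot := hV.pot_le_add (N := N) (a := 1) (c := 1) (m := m) (B := B) fun x _ => by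
        simpa using levelPot_send_first_le (x := x) hn he heh hmaxR
      rw [expect_pure, hfirst, hthr e (by simp), ENNReal.coe_add, mul_add]
      have h1 : ENNReal.ofReal (pot V g n N m B (e :: R)) ≤
          ENNReal.ofReal (pot V g (n + 1) N m (B.erase n) R) +
            ENNReal.ofReal (Real.goldenRatio ^ 2) * I.w e.id := by
        rw [← ENNReal.ofReal_coe_nnreal, ← ENNReal.ofReal_mul (by positivity)]
        refine (ENNReal.ofReal_le_ofReal ?_).trans ENNReal.ofReal_add_le
        refine hpot.trans ?_
        have : Real.goldenRatio ^ 2 * (I.w e.id : ℝ) = I.w e.id + I.w e.id * Real.goldenRatio := by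
          rw [Real.goldenRatio_sq]
          ring
        rw [this]
        push_cast
        linarith
      calc _ ≤ _ := add_le_add_left (h1.trans (add_le_add_left (hopt m R hm) _)) _
        _ = _ := by ring
    · rw [ge_iff_le, not_le, lt_div_iff₀ Real.goldenRatio_pos] at hdet
      have hne : e ≠ h := by
        rintro rfl
        nlinarith [Real.one_lt_goldenRatio, (I.w e.id).2]
      have hhR : h ∈ R := by simpa [hne.symm] using hh
      have hbest : deliver n (e :: R) C.sent (some h) =
          ⟨R.erase h, Function.update C.sent h.id (some n)⟩ := by
        rw [deliver, List.erase_cons_tail (by simpa using hne), List.filter_cons_of_neg (by simp [he]),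
          hfilter _ List.erase_subset]
      obtain ⟨m₁, m₂, hm₁, hm₂, a₁, c₁, a₂, c₂, hcases, hlevel⟩ :=
        exists_price_deliver (B := B) hn he hm (fun y hy => (hR y hy).le) heh hhR hmaxR
      have hp₁ := hV.pot_le_add fun x hx => (hlevel x (hV.pos x hx)).1
      have hp₂ := hV.pot_le_add fun x hx => (hlevel x (hV.pos x hx)).2
      have hbal := ofReal_le_of_coin invGoldenSq.2.1 invGoldenSq.2.2 (sq_nonneg Real.goldenRatio)
        hp₁ hp₂ (coin_budget (I.w e.id).coe_nonneg (by linarith) hcases)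
      rw [expect_map, expect_coin]
      simp only [if_true, Bool.false_eq_true, if_false]
      rw [hfirst, hbest, hthr e (by simp), hthr h hh, ENNReal.coe_add, ENNReal.coe_add, mul_add,
        mul_add]
      have hone : ENNReal.ofReal invGoldenSq + ENNReal.ofReal (1 - invGoldenSq) = 1 := by
        rw [← ENNReal.ofReal_add invGoldenSq.2.1 (sub_nonneg.2 invGoldenSq.2.2)]
        simp
      set T := ENNReal.ofReal (Real.goldenRatio ^ 2) * (I.throughput C.sent : ℝ≥0∞)
      calc _ ≤ _ := add_le_add_left (hbal.trans (add_le_add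
              (mul_le_mul_right (add_le_add_right (hopt m₁ R hm₁) _) _)
              (mul_le_mul_right (add_le_add_right (hopt m₂ (R.erase h) hm₂) _) _)))
              ((ENNReal.ofReal invGoldenSq + ENNReal.ofReal (1 - invGoldenSq)) * T) |>.trans' (by
                rw [hone, one_mul])
        _ = _ := by ring

/-- One step: the packets that the reference schedule sends are paid for when they arrive. -/
lemma IsLevels.optPot_add_le_expect_step (hV : IsLevels I V g) {b N : ℕ} (hb : 0 < b)
    {S : I.Schedule} (hS : I.Feasible b S) (hN : ∀ p s, S p = some s → s < N) {n : ℕ} (hn : n < N)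
    {C : Config I} (hC : Reachable b n C) :
    ENNReal.ofReal (Real.goldenRatio ^ 2) * I.throughput C.sent + optPot V g N S n C.queue +
        (((I.arrivals n).map fun p => if (S p).isSome then I.w p else 0).sum : ℝ≥0) ≤
      expect (step b Real.goldenRatio invGoldenSq n C) fun C' =>
        ENNReal.ofReal (Real.goldenRatio ^ 2) * I.throughput C'.sent +
          optPot V g N S (n + 1) C'.queue := by
  rw [add_assoc, optPot, ENNReal.biSup_add' (⟨0, fun _ _ _ => le_rfl⟩ : ∃ m : ℕ → ℝ≥0, Antitone m),
    ENNReal.add_biSup' (⟨0, fun _ _ _ => le_rfl⟩ : ∃ m : ℕ → ℝ≥0, Antitone m)]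
  refine iSup₂_le fun m hm => ?_
  obtain ⟨m', hm', h⟩ := hV.exists_price_arrive hb hS hN hC.slotted hm
  rw [add_comm]
  exact (add_le_add_left h _).trans (hV.pot_le_expect_deliver hn hC hm')

/-- The value committed by the reference schedule is covered by the throughput and the potential. -/
lemma IsLevels.committed_le_expect_run (hV : IsLevels I V g) {b N : ℕ} (hb : 0 < b)
    {S : I.Schedule} (hS : I.Feasible b S) (hN : ∀ p s, S p = some s → s < N) (n : ℕ) :
    n ≤ N → (committed S n : ℝ≥0∞) ≤ expect (run I b Real.goldenRatio invGoldenSq n) fun C =>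
      ENNReal.ofReal (Real.goldenRatio ^ 2) * I.throughput C.sent +
        optPot V g N S n C.queue := by
  induction n with
  | zero => simp [committed, released]
  | succ n ih =>
    intro hn
    rw [run, expect_bind, committed_succ, ENNReal.coe_add]
    refine (add_le_add_left (ih (by omega)) _).trans ?_
    rw [← expect_const_add]
    exact expect_mono _ fun C hC =>
      hV.optPot_add_le_expect_step hb hS hN hn (reachable_of_mem_support_run n hC)

end Step

lemma deadline_lt_horizon (p : I.Id) : I.d p < I.horizon :=
  Nat.lt_succ_of_le (Finset.le_sup (Finset.mem_univ p))

lemma committed_horizon {b : ℕ} {S : I.Schedule} (hS : I.Feasible b S) :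
    committed S I.horizon = I.throughput S := by
  refine Finset.sum_subset (Finset.subset_univ _) fun p _ hp => ?_
  cases hs : S p with
  | none => simp
  | some s =>
    have h1 := hS.release_le p s hs
    have h2 := hS.le_deadline p s hs
    have h3 := deadline_lt_horizon p
    exact absurd (Finset.mem_filter.2 ⟨Finset.mem_univ p, by omega⟩) hp

/-- At the horizon the reference schedule has nothing left to send, so the potential vanishes. -/
lemma optPot_horizon {V : Finset ℝ≥0} {g : ℝ≥0 → ℝ≥0} {N b : ℕ} {S : I.Schedule}
    (hS : I.Feasible b S) (Q : List (Item I)) : optPot V g N S I.horizon Q = 0 := by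
  have hB : booked S I.horizon (released I I.horizon) = ∅ := by
    rw [Finset.eq_empty_iff_forall_notMem]
    intro s hs
    obtain ⟨h1, p, -, hp⟩ := mem_booked.1 hs
    have h2 := hS.le_deadline p s hp
    have h3 := deadline_lt_horizon p
    omega
  simp only [optPot, ENNReal.iSup_eq_zero, ENNReal.ofReal_eq_zero]
  refine fun m _ => Finset.sum_nonpos fun x _ => mul_nonpos_of_nonneg_of_nonpos (g x).2 ?_
  have : levelPot x I.horizon N m (booked S I.horizon (released I I.horizon)) Q ≤ 0 := by
    unfold levelPot
    rw [hB, Finset.card_empty]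
    exact min_le_left _ _
  exact_mod_cast this

lemma throughput_le_expectedThroughput {b : ℕ} (hb : 0 < b) {S : I.Schedule}
    (hS : I.Feasible b S) : (I.throughput S : ℝ≥0∞) ≤ ENNReal.ofReal (Real.goldenRatio ^ 2) *
      I.expectedThroughput (rme b Real.goldenRatio invGoldenSq I) := by
  obtain ⟨V, g, hV⟩ := exists_isLevels I
  have h := hV.committed_le_expect_run (N := I.horizon) hb hS
    (fun p s hs => (hS.le_deadline p s hs).trans_lt (deadline_lt_horizon p)) I.horizon le_rfl
  have hrme : I.expectedThroughput (rme b Real.goldenRatio invGoldenSq I) =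
      expect (run I b Real.goldenRatio invGoldenSq I.horizon) fun C => I.throughput C.sent :=
    expect_map _ Config.sent fun S => (I.throughput S : ℝ≥0∞)
  rw [committed_horizon hS] at h
  refine h.trans_eq ?_
  rw [hrme, expect, expect, ← ENNReal.tsum_mul_left]
  exact tsum_congr fun C => by rw [optPot_horizon hS, add_zero, mul_left_comm]

end FiniteQueue

end

theorem theorem3 (b : ℕ) (hb : 0 < b) :
    FiniteQueue.IsCompetitive b (Real.goldenRatio ^ 2)
      (FiniteQueue.rme b Real.goldenRatio FiniteQueue.invGoldenSq) := by
  refine fun I => ⟨fun S hS => ?_, iSup₂_le fun S hS =>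
    FiniteQueue.throughput_le_expectedThroughput hb hS⟩
  rw [FiniteQueue.rme, PMF.mem_support_map_iff] at hS
  obtain ⟨C, hC, rfl⟩ := hS
  exact (FiniteQueue.reachable_of_mem_support_run _ hC).feasible
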